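/- Let $0<\alpha<1$ and $0<p<1$ be fixed, and put $q=1-p$. For each $n$, consider the trie formed by $n$ independent random infinite binary strings, where the bits of each string are independent with $\mathbb{P}(1)=p$ and $\mathbb{P}(0)=q$. A node at level $k$ is labelled by a word $r\in\{0,1\}^k$, and it is an internal (filled) node if at least two of the $n$ strings begin with $r$. Let $X_k$ be the number of internal nodes at level $k$, let $\overline{X}_k=X_k/2^k$, and let $F_n(\alpha)=\max\{k:\overline{X}_k\ge\alpha\}$ be the $\alpha$-fillup level (well defined for $n\ge2$). Let $\Phi$ denote the standard normal distribution function. Then for each $n$ there is an integer $k_n\ge 0$ such that, as $n\to\infty$, $$k_n=\log_{1/\sqrt{pq}} n-\frac{|\ln(p/q)|}{2\,\bigl(\ln(1/\sqrt{pq})\bigr)^{3/2}}\,\Phi^{-1}(\alpha)\,\sqrt{\ln n}+O(1)$$ and $$\mathbb{P}\bigl(F_n(\alpha)\in\{k_n,\,k_n+1\}\bigr)\to 1 .$$ Moreover, if $p\ne 1/2$, then the same $k_n$ satisfy $$\mathbb{E}\,\overline{X}_{k_n}=\alpha+O\bigl(1/\sqrt{\log_2 n}\bigr)\qquad\text{as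 } n\to\infty .$$ The implied constants may depend on $\alpha$ and $p$. -/

import Mathlib

open MeasureTheory ProbabilityTheory Filter Topology Asymptotics

namespace Trie

noncomputable section

/-- The law of one infinite binary string from a memoryless source: the bits are independent,
each equal to `1` (`true`) with probability `p` and to `0` (`false`) with probability `1 - p`. -/
def stringLaw (p : unitInterval) : Measure (ℕ → Bool) :=
  Measure.infinitePi fun _ : ℕ => bernoulliMeasure true false p

instance (p : unitInterval) : IsProbabilityMeasure (stringLaw p) := by
  unfold stringLaw
  infer_instance

/-- The law of `n` independent random strings. -/
def sampleLaw (p : unitInterval) (n : ℕ) : Measure (Fin n → ℕ → Bool) :=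
  Measure.pi fun _ : Fin n => stringLaw p

instance (p : unitInterval) (n : ℕ) : IsProbabilityMeasure (sampleLaw p n) := by
  unfold sampleLaw
  infer_instance

/-- The word `r` of length `k` is a prefix of the infinite string `x`. -/
def IsPrefix {k : ℕ} (r : Fin k → Bool) (x : ℕ → Bool) : Prop :=
  ∀ j : Fin k, x j = r j

/-- The word `r` of length `k` labels an internal (filled) node at level `k` of the trie built
from the strings `s`: at least two of the inserted strings begin with `r`. -/
def IsInternalNode {n k : ℕ} (s : Fin n → ℕ → Bool) (r : Fin k → Bool) : Prop :=
  ∃ i j : Fin n, i ≠ j ∧ IsPrefix r (s i) ∧ IsPrefix r (s j)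

/-- `X_k`: the number of internal nodes at level `k`. -/
def internalCount {n : ℕ} (s : Fin n → ℕ → Bool) (k : ℕ) : ℕ :=
  Nat.card {r : Fin k → Bool // IsInternalNode s r}

/-- `X_k / 2 ^ k`: the proportion of nodes filled at level `k`. -/
def fillProportion {n : ℕ} (s : Fin n → ℕ → Bool) (k : ℕ) : ℝ :=
  (internalCount s k : ℝ) / 2 ^ k

/-- The `α`-fillup level: the last level at which at least a proportion `α` of the nodes is filled.
For `0 < α ≤ 1` and at least two strings this is a genuine maximum (`isGreatest_fillupLevel`). -/
def fillupLevel {n : ℕ} (α : ℝ) (s : Fin n → ℕ → Bool) : ℕ :=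
  sSup {k : ℕ | α ≤ fillProportion s k}

/-- The standard normal distribution function `Φ`. -/
def normalCDF (x : ℝ) : ℝ := cdf (gaussianReal 0 1) x

/-- The inverse `Φ⁻¹` of the standard normal distribution function, meaningful on `(0, 1)`
(`normalCDF_normalQuantile`). -/
def normalQuantile : ℝ → ℝ := Function.invFun normalCDF

theorem internalCount_le {n : ℕ} (s : Fin n → ℕ → Bool) (k : ℕ) : internalCount s k ≤ n := by
  classical
  have h : ∀ r : {r : Fin k → Bool // IsInternalNode s r}, ∃ i, IsPrefix r.1 (s i) :=
    fun r => let ⟨i, _, _, hi, _⟩ := r.2; ⟨i, hi⟩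
  choose f hf using h
  have hinj : Function.Injective f := by
    intro a b hab
    apply Subtype.ext
    funext j
    rw [← hf a j, ← hf b j, hab]
  simpa [internalCount] using Nat.card_le_card_of_injective f hinj

theorem isGreatest_fillupLevel {n : ℕ} (hn : 2 ≤ n) {α : ℝ} (h0 : 0 < α) (h1 : α ≤ 1)
    (s : Fin n → ℕ → Bool) :
    IsGreatest {k : ℕ | α ≤ fillProportion s k} (fillupLevel α s) := by
  have hne : {k : ℕ | α ≤ fillProportion s k}.Nonempty := by
    refine ⟨0, ?_⟩
    have hroot : IsInternalNode s (k := 0) (fun _ => true) :=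
      ⟨⟨0, by omega⟩, ⟨1, by omega⟩, by simp, fun j => j.elim0, fun j => j.elim0⟩
    have : 0 < internalCount s 0 := by
      have : Nonempty {r : Fin 0 → Bool // IsInternalNode s r} := ⟨⟨_, hroot⟩⟩
      exact Nat.card_pos
    have h2 : (1 : ℝ) ≤ internalCount s 0 := by exact_mod_cast this
    simp only [Set.mem_ofPred_eq, fillProportion, pow_zero, div_one]
    linarith
  have hbdd : BddAbove {k : ℕ | α ≤ fillProportion s k} := by
    obtain ⟨m, hm⟩ := pow_unbounded_of_one_lt ((n : ℝ) / α) (one_lt_two)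
    refine ⟨m, fun k hk => ?_⟩
    by_contra! hlt
    have hk' : α * 2 ^ k ≤ n := by
      have := (le_div_iff₀ (by positivity)).1 (show α ≤ (internalCount s k : ℝ) / 2 ^ k from hk)
      exact this.trans (by exact_mod_cast internalCount_le s k)
    have hpow : (2 : ℝ) ^ m ≤ 2 ^ k := pow_le_pow_right₀ one_le_two hlt.le
    rw [div_lt_iff₀ h0] at hm
    nlinarith
  exact ⟨Nat.sSup_mem hne hbdd, fun k hk => le_csSup hbdd hk⟩

theorem normalCDF_normalQuantile {α : ℝ} (h0 : 0 < α) (h1 : α < 1) :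
    normalCDF (normalQuantile α) = α := by
  apply Function.invFun_eq
  have hc : Continuous normalCDF := by
    have := nullSingletonClass_gaussianReal (μ := 0) (v := 1) one_ne_zero
    rw [continuous_iff_continuousAt]
    intro x
    have hm := (cdf (gaussianReal 0 1)).measure_singleton x
    rw [measure_cdf, measure_singleton, eq_comm, ENNReal.ofReal_eq_zero] at hm
    have hl : Function.leftLim (cdf (gaussianReal 0 1)) x = cdf (gaussianReal 0 1) x :=
      le_antisymm ((monotone_cdf _).leftLim_le le_rfl) (by linarith)
    exact (monotone_cdf (gaussianReal 0 1)).continuousAt_iff_leftLim_eq_rightLim.2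
      (by rw [hl, StieltjesFunction.rightLim_eq])
  obtain ⟨a, ha⟩ := ((tendsto_cdf_atBot (gaussianReal 0 1)).eventually_lt_const h0).exists
  obtain ⟨b, hb⟩ := ((tendsto_cdf_atTop (gaussianReal 0 1)).eventually_const_lt h1).exists
  exact mem_range_of_exists_le_of_exists_ge hc ⟨a, ha.le⟩ ⟨b, hb.le⟩

end

end Trie

namespace Trie

/-! ### The standard normal distribution function -/

/-! The mean fill proportion at level k is the average, over the 2^k words r, of the probability
that a binomial variable with parameters n and P(r) is at least 2. Take q < p, λ = ln(p/q) and L =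
ln(1/√(pq)). A word with j ones expects exp(λ(j - τ)) strings, where τ is `cellThreshold`, so its
chance of being filled passes from near 0 to near 1 within O(1) of j = τ. For a uniform word j is a
symmetric binomial variable, with atoms O(1/√k). Hence the mean is the binomial tail beyond τ up to
O(1/√k) (`abs_meanFill_sub_binomTail_le`), and a Berry–Esseen estimate turns it into Φ((2/√k)(ln n -
kL)/λ). Equating this with α and solving for k gives `criticalLevel`, including its √(ln n) term.

At t levels from there the mean has moved by an amount of order t/√(ln n), against errors D/√(ln n)
with D independent of t, so it crosses α at bounded distance (`exists_meanFill_expansion`). These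
errors are too coarse to compare consecutive levels. The drop over one level is bounded below
directly: the cells with ⌈τ⌉ ones alone lose a constant over √k (`exists_le_meanFill_sub_succ`). The
margin 1/ln n is eventually less than half this drop. So if the mean is at least α + 1/ln n at level
k but not at k + 1, it is at most α - 1/ln n at k + 2. Level k + 1 may lie on either side of α,
whence two possible values.

For p = 1/2 all cells of a level are equally likely. The mean is a function of n/2^k, drops by a
constant per level near the crossing, and need not come close to α.

Finally, an Efron–Stein inequality bounds the variance of the proportion by 2/2^k, a negative power
of n at the levels considered. Chebyshev's inequality with margin 1/ln n then places the actual
proportions on the same sides of α as their means. The proportion decreases with the level, so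
levels k and k + 2 decide the fillup level. -/

theorem normalCDF_sub_eq_integral (x y : ℝ) :
    normalCDF y - normalCDF x = ∫ t in x..y, gaussianPDFReal 0 1 t := by
  have hint : Integrable (gaussianPDFReal 0 1) := integrable_gaussianPDFReal 0 1
  have h : ∀ z, normalCDF z = ∫ t in Set.Iic z, gaussianPDFReal 0 1 t := fun z => by
    rw [normalCDF, cdf_eq_real, measureReal_def, gaussianReal_apply_eq_integral _ one_ne_zero,
      ENNReal.toReal_ofReal]
    exact integral_nonneg fun t => gaussianPDFReal_nonneg _ _ _
  rw [h, h, intervalIntegral.integral_Iic_sub_Iic hint.integrableOn hint.integrableOn]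

theorem gaussianPDFReal_zero_one (x : ℝ) :
    gaussianPDFReal 0 1 x = (√(2 * Real.pi))⁻¹ * Real.exp (-x ^ 2 / 2) := by
  simp [gaussianPDFReal_def]

theorem gaussianPDFReal_zero_one_le_one (x : ℝ) : gaussianPDFReal 0 1 x ≤ 1 := by
  rw [gaussianPDFReal_zero_one]
  have h1 : (√(2 * Real.pi))⁻¹ ≤ 1 := by
    apply inv_le_one_of_one_le₀
    rw [Real.one_le_sqrt]
    nlinarith [Real.pi_gt_three]
  have h2 : Real.exp (-x ^ 2 / 2) ≤ 1 := by
    rw [Real.exp_le_one_iff]; nlinarith [sq_nonneg x]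
  exact mul_le_one₀ h1 (Real.exp_nonneg _) h2

theorem continuous_gaussianPDFReal_zero_one : Continuous (gaussianPDFReal 0 1) := by
  have : gaussianPDFReal 0 1 = fun x => (√(2 * Real.pi))⁻¹ * Real.exp (-x ^ 2 / 2) :=
    funext gaussianPDFReal_zero_one
  rw [this]
  fun_prop

theorem monotone_normalCDF : Monotone normalCDF := monotone_cdf _

theorem normalCDF_sub_le {x y : ℝ} (hxy : x ≤ y) : normalCDF y - normalCDF x ≤ y - x := by
  rw [normalCDF_sub_eq_integral]
  have := intervalIntegral.integral_mono_on hxy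
    (continuous_gaussianPDFReal_zero_one.intervalIntegrable x y)
    (intervalIntegrable_const (c := (1 : ℝ)) (μ := volume) (a := x) (b := y))
    (fun t _ => gaussianPDFReal_zero_one_le_one t)
  simpa using this

theorem abs_normalCDF_sub_le (x y : ℝ) : |normalCDF x - normalCDF y| ≤ |x - y| := by
  rcases le_total x y with h | h
  · rw [abs_sub_comm, abs_sub_comm x y, abs_of_nonneg (sub_nonneg.2 (monotone_normalCDF h)),
      abs_of_nonneg (sub_nonneg.2 h)]
    exact normalCDF_sub_le h
  · rw [abs_of_nonneg (sub_nonneg.2 (monotone_normalCDF h)), abs_of_nonneg (sub_nonneg.2 h)]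
    exact normalCDF_sub_le h

theorem le_normalCDF_sub {A x y : ℝ} (hx : -A ≤ x) (hxy : x ≤ y) (hy : y ≤ A) :
    gaussianPDFReal 0 1 A * (y - x) ≤ normalCDF y - normalCDF x := by
  rw [normalCDF_sub_eq_integral]
  have := intervalIntegral.integral_mono_on hxy
    (intervalIntegrable_const (c := gaussianPDFReal 0 1 A) (μ := volume) (a := x) (b := y))
    (continuous_gaussianPDFReal_zero_one.intervalIntegrable x y)
    (fun t ht => by
      rw [gaussianPDFReal_zero_one, gaussianPDFReal_zero_one]
      have : t ^ 2 ≤ A ^ 2 := sq_le_sq' (by linarith [ht.1]) (by linarith [ht.2])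
      gcongr)
  simpa [mul_comm] using this

theorem normalCDF_neg (x : ℝ) : normalCDF (-x) = 1 - normalCDF x := by
  have hns := nullSingletonClass_gaussianReal (μ := 0) (v := 1) one_ne_zero
  have h1 : (gaussianReal 0 1).real (Set.Iic (-x)) = (gaussianReal 0 1).real (Set.Ici x) := by
    have hmap := gaussianReal_map_neg (μ := 0) (v := 1)
    rw [neg_zero] at hmap
    conv_lhs => rw [← hmap]
    rw [map_measureReal_apply measurable_neg measurableSet_Iic]
    congr 1
    ext t
    simp
  have h2 : (gaussianReal 0 1).real (Set.Iio x) = (gaussianReal 0 1).real (Set.Iic x) :=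
    measureReal_congr Iio_ae_eq_Iic
  rw [normalCDF, normalCDF, cdf_eq_real, cdf_eq_real, h1, ← Set.compl_Iio,
    probReal_compl_eq_one_sub measurableSet_Iio, h2]

theorem normalCDF_zero : normalCDF 0 = 1 / 2 := by
  have := normalCDF_neg 0
  rw [neg_zero] at this
  linarith

/-! ### The symmetric binomial distribution -/

noncomputable section

/-- The probability that a symmetric binomial variable with `k` trials equals `j`. -/
def binomProb (k j : ℕ) : ℝ := (k.choose j : ℝ) / 2 ^ k

end

theorem binomProb_nonneg (k j : ℕ) : 0 ≤ binomProb k j := by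
  unfold binomProb; positivity

theorem sum_binomProb (k : ℕ) : ∑ j ∈ Finset.range (k + 1), binomProb k j = 1 := by
  simp only [binomProb, ← Finset.sum_div]
  rw [div_eq_one_iff_eq (by positivity)]
  exact_mod_cast Nat.sum_range_choose k

theorem binomProb_symm {k j : ℕ} (h : j ≤ k) : binomProb k (k - j) = binomProb k j := by
  rw [binomProb, binomProb, Nat.choose_symm h]

/-- Local estimates are made for an even number of trials, where the centre is an integer; this
carries lower bounds over to odd numbers. -/
theorem half_binomProb_le_succ (k j : ℕ) : binomProb k j / 2 ≤ binomProb (k + 1) j := by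
  have h : (k.choose j : ℝ) ≤ (k + 1).choose j := by
    exact_mod_cast Nat.choose_le_choose j (Nat.le_succ k)
  rw [binomProb, binomProb, pow_succ, div_div]
  gcongr

/-- The central binomial coefficient is a partial Wallis product in disguise, so the two-sided
bounds on `Real.Wallis.W` give the sharp constant 1/√(πm). -/
theorem sq_binomProb_central (m : ℕ) :
    binomProb (2 * m) m ^ 2 * (Real.Wallis.W m * (2 * m + 1)) = 1 := by
  rw [Real.Wallis.W_eq_factorial_ratio, binomProb]
  have h : ((2 * m).choose m : ℝ) * (m.factorial ^ 2) = (2 * m).factorial := by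
    have := Nat.choose_mul_factorial_mul_factorial (show m ≤ 2 * m by omega)
    rw [show 2 * m - m = m by omega] at this
    rw [← this]; push_cast; ring
  have h0 : ((2 * m).factorial : ℝ) ≠ 0 := by positivity
  have h2 : (2 : ℝ) ^ (4 * m) = (2 ^ (2 * m)) ^ 2 := by rw [← pow_mul]; ring_nf
  rw [h2]
  field_simp
  rw [← h]; ring

theorem binomProb_central_le {m : ℕ} (hm : 0 < m) :
    binomProb (2 * m) m ≤ 1 / √(Real.pi * m) := by
  have hm' : (0 : ℝ) < m := by exact_mod_cast hm
  have hpi := Real.pi_pos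
  rw [← sq_le_sq₀ (binomProb_nonneg _ _) (by positivity)]
  rw [div_pow, Real.sq_sqrt (by positivity), one_pow]
  have h := sq_binomProb_central m
  have hW := Real.Wallis.le_W m
  rw [le_div_iff₀ (by positivity)]
  have h3 : Real.pi * m ≤ Real.Wallis.W m * (2 * m + 1) := by
    refine le_trans ?_ (mul_le_mul_of_nonneg_right hW (by positivity))
    rw [div_mul_eq_mul_div, div_mul_eq_mul_div, le_div_iff₀ (by positivity)]
    nlinarith
  calc _ ≤ _ := mul_le_mul_of_nonneg_left h3 (sq_nonneg _)
    _ = 1 := h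

theorem le_binomProb_central {m : ℕ} (hm : 0 < m) :
    1 / √(Real.pi * m) - 1 / m ≤ binomProb (2 * m) m := by
  have hm' : (0 : ℝ) < m := by exact_mod_cast hm
  have hm1 : (1 : ℝ) ≤ m := by exact_mod_cast hm
  have hpi := Real.pi_pos
  have h := sq_binomProb_central m
  have hW := Real.Wallis.W_le m
  have hB := binomProb_nonneg (2 * m) m
  set B := binomProb (2 * m) m
  set s := √(Real.pi * m) with hs
  have hs2 : s ^ 2 = Real.pi * m := Real.sq_sqrt (by positivity)
  have hs1 : 1 ≤ s := by
    rw [hs, Real.one_le_sqrt]; nlinarith [Real.pi_gt_three]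
  have h3 : 1 ≤ B ^ 2 * (Real.pi * (m + 1 / 2)) := by
    rw [← h]
    apply mul_le_mul_of_nonneg_left _ (sq_nonneg _)
    nlinarith
  have h4 : 1 ≤ (B * s * (1 + 1 / (2 * m))) ^ 2 := by
    rw [mul_pow, mul_pow, hs2]
    refine h3.trans ?_
    rw [mul_assoc]
    apply mul_le_mul_of_nonneg_left _ (sq_nonneg _)
    have : (m : ℝ) * (1 + 1 / (2 * m)) = m + 1 / 2 := by field_simp
    calc Real.pi * (m + 1 / 2) = Real.pi * m * (1 + 1 / (2 * m)) * 1 := by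
          rw [mul_assoc Real.pi, this]; ring
      _ ≤ Real.pi * m * (1 + 1 / (2 * m)) * (1 + 1 / (2 * m)) := by
        gcongr
        simp
      _ = _ := by ring
  have h5 : 1 ≤ B * s * (1 + 1 / (2 * m)) := by
    have h0 : 0 ≤ B * s * (1 + 1 / (2 * m)) := by positivity
    nlinarith
  have h6 : B * s ≤ 1 := by
    have := binomProb_central_le hm
    rwa [le_div_iff₀ (by positivity)] at this
  have h7 : 1 - 1 / (2 * m) ≤ B * s := by
    have : B * s * (1 / (2 * m)) ≤ 1 / (2 * m) := by
      exact mul_le_of_le_one_left (by positivity) h6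
    nlinarith
  have h8 : 1 / s - 1 / m ≤ (1 - 1 / (2 * m)) / s := by
    rw [sub_div]
    have : 1 / (2 * (m : ℝ)) / s ≤ 1 / m := by
      rw [div_div]
      apply one_div_le_one_div_of_le (by positivity)
      nlinarith
    linarith
  calc _ ≤ _ := h8
    _ ≤ B * s / s := by gcongr
    _ = B := by field_simp

theorem binomProb_le_central (k j : ℕ) : binomProb k j ≤ binomProb k (k / 2) := by
  unfold binomProb
  have : (k.choose j : ℝ) ≤ k.choose (k / 2) := by exact_mod_cast Nat.choose_le_middle j k
  gcongr

/-- With its companion below, this bounds each factor of a product of ratios with only a quadratic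
error in the exponent. -/
theorem exp_sub_sq_le_one_add {v : ℝ} (hv : 0 ≤ v) : Real.exp (v - v ^ 2) ≤ 1 + v := by
  have h := Real.le_log_one_add_of_nonneg hv
  rw [← Real.le_log_iff_exp_le (by linarith)]
  refine le_trans ?_ h
  rw [le_div_iff₀ (by linarith)]
  nlinarith [mul_nonneg hv hv, pow_nonneg hv 3]

theorem exp_neg_sub_sq_le_one_sub {u : ℝ} (h0 : 0 ≤ u) (h1 : u ≤ 1 / 2) : Real.exp (-u - u ^ 2) ≤ 1 - u := by
  have hpos : 0 < 1 - u := by linarith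
  have h : Real.exp (u + u ^ 2) ≥ 1 / (1 - u) := by
    have h2 := Real.quadratic_le_exp_of_nonneg (show 0 ≤ u + u ^ 2 by positivity)
    refine le_trans ?_ h2
    rw [div_le_iff₀ hpos]
    nlinarith [mul_nonneg h0 h0, pow_nonneg h0 3, pow_nonneg h0 4,
      mul_nonneg (pow_nonneg h0 2) (sub_nonneg.2 h1),
      mul_nonneg (pow_nonneg h0 3) (sub_nonneg.2 h1),
      mul_nonneg (pow_nonneg h0 4) (sub_nonneg.2 h1)]
  rw [show -u - u ^ 2 = -(u + u ^ 2) by ring, Real.exp_neg]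
  rw [inv_le_comm₀ (Real.exp_pos _) hpos]
  simpa using h

theorem binomProb_succ_mul {m j : ℕ} (hj : j ≤ m) :
    binomProb (2 * m) (m + (j + 1)) * ((m : ℝ) + (j + 1)) =
      binomProb (2 * m) (m + j) * ((m : ℝ) - j) := by
  have h := Nat.choose_succ_right_eq (2 * m) (m + j)
  have h' : ((2 * m).choose (m + (j + 1)) : ℝ) * ((m : ℝ) + (j + 1)) =
      (2 * m).choose (m + j) * ((m : ℝ) - j) := by
    rw [show 2 * m - (m + j) = m - j by omega] at h
    have := congrArg (Nat.cast : ℕ → ℝ) h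
    push_cast [Nat.cast_sub hj] at this
    rw [← this]; ring_nf
  rw [binomProb, binomProb, div_mul_eq_mul_div, h', div_mul_eq_mul_div]

/-- Comparison of the symmetric binomial probabilities with a Gaussian profile. -/
theorem binomProb_gaussian_bounds {m : ℕ} (hm : 0 < m) (j : ℕ) (hj : 2 * j ≤ m) :
    binomProb (2 * m) m * Real.exp (-(j : ℝ) ^ 2 / m - (j : ℝ) ^ 3 / m ^ 2) ≤
        binomProb (2 * m) (m + j) ∧
      binomProb (2 * m) (m + j) ≤
        binomProb (2 * m) m * Real.exp (-(j : ℝ) ^ 2 / m + (j : ℝ) ^ 3 / m ^ 2) := by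
  have hm' : (0 : ℝ) < m := by exact_mod_cast hm
  induction j with
  | zero => simp
  | succ j ih =>
    obtain ⟨ih1, ih2⟩ := ih (by omega)
    have hjm : 2 * ((j : ℝ) + 1) ≤ m := by exact_mod_cast hj
    have hj0 : (0 : ℝ) ≤ j := by positivity
    have hr := binomProb_succ_mul (m := m) (j := j) (by omega)
    set u : ℝ := j / m with hu
    set v : ℝ := (j + 1) / m with hv
    have hu0 : 0 ≤ u := by positivity
    have hv0 : 0 ≤ v := by positivity
    have hu1 : u ≤ 1 / 2 := by rw [hu, div_le_iff₀ hm']; linarith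
    have hr' : binomProb (2 * m) (m + (j + 1)) * (1 + v) =
        binomProb (2 * m) (m + j) * (1 - u) := by
      rw [hu, hv]
      field_simp
      linear_combination hr
    -- The ratio of consecutive atoms is (1 - u)/(1 + v), about exp(-(u + v)), and u + v is the
    -- increment of j²/m. The increment of j³/m² contains both u² and v², so it absorbs the error
    -- made at each step.
    have e1 : (((j + 1 : ℕ) : ℝ)) ^ 2 / m = (j : ℝ) ^ 2 / m + (u + v) := by
      rw [hu, hv]; push_cast; field_simp; ring
    have e2 : (((j + 1 : ℕ) : ℝ)) ^ 3 / m ^ 2 = (j : ℝ) ^ 3 / m ^ 2 + (u ^ 2 + u * v + v ^ 2) := by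
      rw [hu, hv]; push_cast; field_simp; ring
    have hB := binomProb_nonneg (2 * m) m
    constructor
    · rw [← mul_le_mul_iff_left₀ (show 0 < 1 + v by positivity), hr']
      have hx : Real.exp (-(((j + 1 : ℕ) : ℝ)) ^ 2 / m - ((j + 1 : ℕ) : ℝ) ^ 3 / m ^ 2) * (1 + v) ≤
          Real.exp (-(j : ℝ) ^ 2 / m - (j : ℝ) ^ 3 / m ^ 2) * (1 - u) := by
        have hv1 : 1 + v ≤ Real.exp v := by linarith [Real.add_one_le_exp v]
        calc _ ≤ Real.exp (-(((j + 1 : ℕ) : ℝ)) ^ 2 / m - ((j + 1 : ℕ) : ℝ) ^ 3 / m ^ 2) *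
              Real.exp v := by gcongr
          _ = Real.exp (-(((j + 1 : ℕ) : ℝ)) ^ 2 / m - ((j + 1 : ℕ) : ℝ) ^ 3 / m ^ 2 + v) := by
              rw [Real.exp_add]
          _ ≤ Real.exp ((-(j : ℝ) ^ 2 / m - (j : ℝ) ^ 3 / m ^ 2) + (-u - u ^ 2)) := by
              apply Real.exp_le_exp.2
              rw [e2, neg_div, neg_div, e1]
              nlinarith [mul_nonneg hu0 hv0, sq_nonneg v]
          _ = _ := Real.exp_add _ _
          _ ≤ _ := by gcongr; exact exp_neg_sub_sq_le_one_sub hu0 hu1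
      calc _ = binomProb (2 * m) m * (Real.exp (-(((j + 1 : ℕ) : ℝ)) ^ 2 / m -
                ((j + 1 : ℕ) : ℝ) ^ 3 / m ^ 2) * (1 + v)) := by ring
        _ ≤ binomProb (2 * m) m *
              (Real.exp (-(j : ℝ) ^ 2 / m - (j : ℝ) ^ 3 / m ^ 2) * (1 - u)) := by
            gcongr
        _ = binomProb (2 * m) m * Real.exp (-(j : ℝ) ^ 2 / m - (j : ℝ) ^ 3 / m ^ 2) * (1 - u) := by
            ring
        _ ≤ _ := by gcongr; linarith
    · rw [← mul_le_mul_iff_left₀ (show 0 < 1 + v by positivity), hr']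
      have hx : Real.exp (-(j : ℝ) ^ 2 / m + (j : ℝ) ^ 3 / m ^ 2) * (1 - u) ≤
          Real.exp (-(((j + 1 : ℕ) : ℝ)) ^ 2 / m + ((j + 1 : ℕ) : ℝ) ^ 3 / m ^ 2) * (1 + v) := by
        have hu2 : 1 - u ≤ Real.exp (-u) := by linarith [Real.add_one_le_exp (-u)]
        calc _ ≤ Real.exp (-(j : ℝ) ^ 2 / m + (j : ℝ) ^ 3 / m ^ 2) * Real.exp (-u) := by gcongr
          _ = Real.exp (-(j : ℝ) ^ 2 / m + (j : ℝ) ^ 3 / m ^ 2 + -u) :=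
              (Real.exp_add _ _).symm
          _ ≤ Real.exp ((-(((j + 1 : ℕ) : ℝ)) ^ 2 / m + ((j + 1 : ℕ) : ℝ) ^ 3 / m ^ 2) +
                (v - v ^ 2)) := by
              apply Real.exp_le_exp.2
              rw [e2, neg_div, neg_div, e1]
              nlinarith [mul_nonneg hu0 hv0, sq_nonneg u]
          _ = _ := Real.exp_add _ _
          _ ≤ _ := by gcongr; exact exp_sub_sq_le_one_add hv0
      calc _ ≤ binomProb (2 * m) m * Real.exp (-(j : ℝ) ^ 2 / m + (j : ℝ) ^ 3 / m ^ 2) *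
                (1 - u) := by gcongr; linarith
        _ = binomProb (2 * m) m *
              (Real.exp (-(j : ℝ) ^ 2 / m + (j : ℝ) ^ 3 / m ^ 2) * (1 - u)) := by
            ring
        _ ≤ binomProb (2 * m) m * (Real.exp (-(((j + 1 : ℕ) : ℝ)) ^ 2 / m +
                ((j + 1 : ℕ) : ℝ) ^ 3 / m ^ 2) * (1 + v)) := by gcongr
        _ = _ := by ring

theorem abs_exp_sub_exp_le {a b : ℝ} (ha : a ≤ 0) (hb : b ≤ 0) :
    |Real.exp a - Real.exp b| ≤ |a - b| := by
  wlog h : b ≤ a generalizing a b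
  · rw [abs_sub_comm, abs_sub_comm a b]
    exact this hb ha (le_of_not_ge h)
  rw [abs_of_nonneg (sub_nonneg.2 (Real.exp_le_exp.2 h)), abs_of_nonneg (sub_nonneg.2 h)]
  have h1 : Real.exp b = Real.exp a * Real.exp (b - a) := by rw [← Real.exp_add]; ring_nf
  have h2 : b - a + 1 ≤ Real.exp (b - a) := Real.add_one_le_exp _
  have h3 : Real.exp a ≤ 1 := Real.exp_le_one_iff.2 ha
  have h4 : Real.exp (b - a) ≤ 1 := Real.exp_le_one_iff.2 (by linarith)
  rw [h1]
  nlinarith [Real.exp_pos a]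

theorem one_div_sqrt_pi_mul_le (m : ℕ) : 1 / √(Real.pi * m) ≤ 1 / √m := by
  rcases Nat.eq_zero_or_pos m with rfl | hm
  · simp
  have hm' : (0 : ℝ) < m := by exact_mod_cast hm
  apply one_div_le_one_div_of_le (by positivity)
  apply Real.sqrt_le_sqrt
  nlinarith [Real.pi_gt_three]

theorem binomProb_even_le {m : ℕ} (hm : 0 < m) (j : ℕ) : binomProb (2 * m) j ≤ 1 / √m := by
  refine (binomProb_le_central _ _).trans ?_
  rw [show 2 * m / 2 = m by omega]
  exact (binomProb_central_le hm).trans (one_div_sqrt_pi_mul_le m)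

theorem two_mul_le_of_le_mul_sqrt {A : ℝ} {m j : ℕ} (hmA : 4 * A ^ 2 ≤ m)
    (hj : j ≤ A * √m) : 2 * j ≤ m := by
  have h1 : 2 * A ≤ √m := Real.le_sqrt_of_sq_le (by nlinarith)
  have h2 : √(m : ℝ) * √m = m := Real.mul_self_sqrt (by positivity)
  have h3 : (2 * j : ℝ) ≤ m := by nlinarith [Real.sqrt_nonneg (m : ℝ)]
  exact_mod_cast h3

theorem cube_div_sq_le {A : ℝ} {m j : ℕ} (hm : 0 < m) (hj : j ≤ A * √m) :
    (j : ℝ) ^ 3 / m ^ 2 ≤ A ^ 3 / √m := by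
  have hm' : (0 : ℝ) < m := by exact_mod_cast hm
  have hs : (0 : ℝ) < √m := Real.sqrt_pos.2 hm'
  have h2 : (m : ℝ) = √m ^ 2 := (Real.sq_sqrt hm'.le).symm
  rw [div_le_div_iff₀ (by positivity) hs]
  calc (j : ℝ) ^ 3 * √m ≤ (A * √m) ^ 3 * √m := by gcongr
    _ = A ^ 3 * (√m ^ 2) ^ 2 := by ring
    _ = _ := by rw [← h2]

/-- Local limit theorem for the symmetric binomial distribution, with an error term. -/
theorem abs_binomProb_sub_gaussian_le {A : ℝ} {m j : ℕ} (hm : 0 < m)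
    (hmA : 4 * A ^ 2 ≤ m) (hj : j ≤ A * √m) :
    |binomProb (2 * m) (m + j) - 1 / √(Real.pi * m) * Real.exp (-(j : ℝ) ^ 2 / m)| ≤
      (1 + A ^ 3) / m := by
  have hm' : (0 : ℝ) < m := by exact_mod_cast hm
  have hs : (0 : ℝ) < √m := Real.sqrt_pos.2 hm'
  have h2j := two_mul_le_of_le_mul_sqrt hmA hj
  have h2j' : (2 * j : ℝ) ≤ m := by exact_mod_cast h2j
  obtain ⟨hl, hu⟩ := binomProb_gaussian_bounds hm j h2j
  have hε := cube_div_sq_le hm hj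
  have hε0 : (0 : ℝ) ≤ (j : ℝ) ^ 3 / m ^ 2 := by positivity
  -- The cubic correction does not exceed the quadratic term, so the exponent -x + ε stays
  -- nonpositive, where the exponential is 1-Lipschitz.
  have hεx : (j : ℝ) ^ 3 / m ^ 2 ≤ (j : ℝ) ^ 2 / m := by
    rw [div_le_div_iff₀ (by positivity) hm']
    have : (0 : ℝ) ≤ (j : ℝ) ^ 2 * m := by positivity
    nlinarith
  rw [neg_div] at hl hu ⊢
  set ε := (j : ℝ) ^ 3 / m ^ 2
  set x := (j : ℝ) ^ 2 / m
  have hx0 : 0 ≤ x := by positivity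
  set c := 1 / √(Real.pi * m)
  set B := binomProb (2 * m) m
  have hB0 : 0 ≤ B := binomProb_nonneg _ _
  have hBc : B ≤ c := binomProb_central_le hm
  have hcB : c - 1 / m ≤ B := le_binomProb_central hm
  have hcm : c ≤ 1 / √m := one_div_sqrt_pi_mul_le m
  have hBs : B ≤ 1 / √m := hBc.trans hcm
  have hex : Real.exp (-x) ≤ 1 := Real.exp_le_one_iff.2 (by linarith)
  have hex0 := Real.exp_pos (-x)
  have e1 : Real.exp (-x + ε) ≤ Real.exp (-x) + ε := by
    have := abs_exp_sub_exp_le (show -x + ε ≤ 0 by linarith) (show -x ≤ 0 by linarith)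
    rw [show -x + ε - -x = ε by ring, abs_of_nonneg hε0] at this
    linarith [le_abs_self (Real.exp (-x + ε) - Real.exp (-x))]
  have e2 : Real.exp (-x) - ε ≤ Real.exp (-x - ε) := by
    have := abs_exp_sub_exp_le (show -x ≤ 0 by linarith) (show -x - ε ≤ 0 by linarith)
    rw [show -x - (-x - ε) = ε by ring, abs_of_nonneg hε0] at this
    linarith [le_abs_self (Real.exp (-x) - Real.exp (-x - ε))]
  have hBε : B * ε ≤ A ^ 3 / m := by
    calc B * ε ≤ 1 / √m * (A ^ 3 / √m) := by gcongr
      _ = A ^ 3 / m := by rw [div_mul_div_comm, one_mul, Real.mul_self_sqrt hm'.le]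
  rw [add_div, abs_le]
  constructor
  · have h1 : B * (Real.exp (-x) - ε) ≤ B * Real.exp (-x - ε) := by gcongr
    have h3 : (c - B) * Real.exp (-x) ≤ 1 / m := by
      calc (c - B) * Real.exp (-x) ≤ (c - B) * 1 := by
            apply mul_le_mul_of_nonneg_left hex; linarith
        _ ≤ _ := by linarith
    nlinarith
  · have h1 : B * Real.exp (-x + ε) ≤ B * (Real.exp (-x) + ε) := by gcongr
    have h3 : B * Real.exp (-x) ≤ c * Real.exp (-x) := by gcongr
    have h4 : (0 : ℝ) ≤ 1 / m := by positivity
    nlinarith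

theorem integral_gaussian_profile {m : ℕ} (hm : 0 < m) (J : ℕ) :
    ∫ t in (0 : ℝ)..J, 1 / √(Real.pi * m) * Real.exp (-t ^ 2 / m) =
      normalCDF (J * √(2 / m)) - 1 / 2 := by
  have hm' : (0 : ℝ) < m := by exact_mod_cast hm
  have hc2 : √(2 / m : ℝ) ^ 2 = 2 / m := Real.sq_sqrt (by positivity)
  rw [← normalCDF_zero, normalCDF_sub_eq_integral]
  have h := intervalIntegral.smul_integral_comp_mul_left (a := 0) (b := (J : ℝ))
    (gaussianPDFReal 0 1) (√(2 / m : ℝ))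
  rw [mul_zero, mul_comm] at h
  rw [← h, smul_eq_mul, ← intervalIntegral.integral_const_mul]
  congr 1
  ext t
  rw [gaussianPDFReal_zero_one, mul_pow, hc2, ← mul_assoc]
  congr 1
  · rw [Real.sqrt_div zero_le_two, Real.sqrt_mul zero_le_two, Real.sqrt_mul Real.pi_pos.le]
    field_simp
  · congr 1
    field_simp

/-- There are at most A√m local errors of size O(1/m). The sum of the decreasing Gaussian profile
differs from its integral by at most its value at 0, which is at most 1/√m. -/
theorem abs_sum_binomProb_sub_normalCDF_le {A : ℝ} (hA : 0 ≤ A) {m J : ℕ} (hm : 0 < m)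
    (hmA : 4 * A ^ 2 ≤ m) (hJ : J ≤ A * √m) :
    |∑ i ∈ Finset.range J, binomProb (2 * m) (m + i) - (normalCDF (J * √(2 / m)) - 1 / 2)| ≤
      (A * (1 + A ^ 3) + 1) / √m := by
  have hm' : (0 : ℝ) < m := by exact_mod_cast hm
  have hs : (0 : ℝ) < √m := Real.sqrt_pos.2 hm'
  set g : ℝ → ℝ := fun t => 1 / √(Real.pi * m) * Real.exp (-t ^ 2 / m) with hg
  have hanti : AntitoneOn g (Set.Icc 0 (0 + (J : ℝ))) := by
    intro a ha b hb hab
    have ha0 : 0 ≤ a := ha.1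
    simp only [hg]
    gcongr
  have hI : ∫ t in (0 : ℝ)..(0 + J), g t = normalCDF (J * √(2 / m)) - 1 / 2 := by
    rw [zero_add]; exact integral_gaussian_profile hm J
  have h1 := hanti.integral_le_sum
  have h2 := hanti.sum_le_integral
  rw [hI] at h1 h2
  simp only [zero_add] at h1 h2
  have h3 : ∑ i ∈ Finset.range J, g i ≤ ∑ i ∈ Finset.range J, g ((i + 1 : ℕ) : ℝ) + g 0 := by
    have ha := Finset.sum_range_succ (fun i : ℕ => g i) J
    have hb := Finset.sum_range_succ' (fun i : ℕ => g i) J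
    have hc : 0 ≤ g J := by simp only [hg]; positivity
    simp only [Nat.cast_zero] at hb
    linarith
  have hg0 : g 0 ≤ 1 / √m := by
    simp only [hg]
    simpa using one_div_sqrt_pi_mul_le m
  have h4 : |∑ i ∈ Finset.range J, binomProb (2 * m) (m + i) - ∑ i ∈ Finset.range J, g i| ≤
      A * (1 + A ^ 3) / √m := by
    rw [← Finset.sum_sub_distrib]
    refine (Finset.abs_sum_le_sum_abs _ _).trans ?_
    calc _ ≤ ∑ i ∈ Finset.range J, (1 + A ^ 3) / (m : ℝ) := by
          apply Finset.sum_le_sum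
          intro i hi
          apply abs_binomProb_sub_gaussian_le hm hmA
          have : (i : ℝ) ≤ J := by exact_mod_cast (Finset.mem_range.1 hi).le
          exact this.trans hJ
      _ = J * ((1 + A ^ 3) / m) := by simp
      _ ≤ A * √m * ((1 + A ^ 3) / m) := by gcongr
      _ = _ := by
        nth_rewrite 2 [← Real.sq_sqrt hm'.le]
        field_simp
  rw [add_div]
  rw [abs_le] at h4 ⊢
  constructor <;> linarith

/-! ### Tails and local lower bounds of the symmetric binomial distribution -/

noncomputable section

/-- The probability that a symmetric binomial variable with `k` trials is at least `N`. -/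
def binomTail (k N : ℕ) : ℝ := ∑ j ∈ Finset.Ico N (k + 1), binomProb k j

end

/-- The reflection j ↦ k - j; it reduces thresholds below the mean to thresholds above it. -/
theorem binomTail_add_binomTail {k N : ℕ} (h : N ≤ k + 1) :
    binomTail k N + binomTail k (k + 1 - N) = 1 := by
  have h1 : binomTail k (k + 1 - N) = ∑ j ∈ Finset.range N, binomProb k j := by
    rw [binomTail, ← Finset.sum_range_reflect, Finset.sum_Ico_eq_sum_range,
      show k + 1 - (k + 1 - N) = N by omega]
    apply Finset.sum_congr rfl
    intro j hj
    have hj' := Finset.mem_range.1 hj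
    rw [← binomProb_symm (show N - 1 - j ≤ k by omega)]
    congr 1
    omega
  rw [h1, binomTail, ← sum_binomProb k, add_comm]
  exact Finset.sum_range_add_sum_Ico _ h

theorem abs_binomTail_sub_normalCDF_le {A : ℝ} (hA : 0 ≤ A) {m J : ℕ} (hm : 0 < m)
    (hmA : 4 * A ^ 2 ≤ m) (hJ : J ≤ A * √m) :
    |binomTail (2 * m) (m + J) - normalCDF (-(J * √(2 / m)))| ≤
      (A * (1 + A ^ 3) + 2) / √m := by
  have hm' : (0 : ℝ) < m := by exact_mod_cast hm
  have hJm := two_mul_le_of_le_mul_sqrt hmA hJ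
  have h1 := abs_sum_binomProb_sub_normalCDF_le hA hm hmA hJ
  -- By symmetry the tail from the centre is one half plus half the central atom, which costs a
  -- further O(1/√m).
  have h2 : binomTail (2 * m) m = 1 / 2 + binomProb (2 * m) m / 2 := by
    have := binomTail_add_binomTail (k := 2 * m) (N := m) (by omega)
    rw [show 2 * m + 1 - m = m + 1 by omega] at this
    have h3 : binomTail (2 * m) m = binomProb (2 * m) m + binomTail (2 * m) (m + 1) :=
      Finset.sum_eq_sum_Ico_succ_bot (by omega) _
    linarith
  have h3 : binomTail (2 * m) m =
      ∑ i ∈ Finset.range J, binomProb (2 * m) (m + i) + binomTail (2 * m) (m + J) := by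
    have := Finset.sum_Ico_consecutive (binomProb (2 * m)) (show m ≤ m + J by omega)
      (show m + J ≤ 2 * m + 1 by omega)
    rw [binomTail, binomTail, ← this, Finset.sum_Ico_eq_sum_range, Nat.add_sub_cancel_left]
  have h4 := binomProb_even_le hm m
  have h5 := binomProb_nonneg (2 * m) m
  rw [normalCDF_neg]
  have h6 : (A * (1 + A ^ 3) + 2) / √m = (A * (1 + A ^ 3) + 1) / √m + 1 / √m := by
    rw [← add_div]; ring_nf
  rw [h6]
  rw [abs_le] at h1 ⊢
  constructor <;> linarith

/-- A Berry–Esseen estimate for the symmetric binomial distribution with an even number of trials,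
uniform over thresholds within a bounded number of standard deviations of the mean. -/
theorem exists_abs_binomTail_ceil_sub_normalCDF_le (A : ℝ) :
    ∃ C : ℝ, 0 < C ∧ ∃ m₀ : ℕ, ∀ m ≥ m₀, ∀ τ : ℝ, |(m - τ) * √(2 / m)| ≤ A →
      |binomTail (2 * m) ⌈τ⌉₊ - normalCDF ((m - τ) * √(2 / m))| ≤ C / √m := by
  wlog hA : 0 ≤ A generalizing A
  · refine ⟨1, one_pos, 0, fun m _ τ h => ?_⟩
    exact absurd ((abs_nonneg _).trans h) hA
  -- The enlarged window leaves room for rounding τ up and for the shift by one in the reflection.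
  set D := A + 2 with hD
  obtain ⟨m₀, hm₀⟩ := exists_nat_ge (4 * D ^ 2)
  refine ⟨D * (1 + D ^ 3) + 2 + 4, by positivity, m₀ + 1, fun m hm τ hτ => ?_⟩
  have hm1 : 0 < m := by omega
  have hm' : (0 : ℝ) < m := by exact_mod_cast hm1
  have hmD : 4 * D ^ 2 ≤ m := hm₀.trans (by exact_mod_cast (by omega : m₀ ≤ m))
  have hs : (0 : ℝ) < √m := Real.sqrt_pos.2 hm'
  have hs1 : 1 ≤ √(m : ℝ) := by rw [Real.one_le_sqrt]; exact_mod_cast hm1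
  have hss : √(m : ℝ) * √m = m := Real.mul_self_sqrt hm'.le
  set c := √(2 / m : ℝ) with hc
  have hc1 : c = √2 / √m := Real.sqrt_div zero_le_two _
  have h2a : (1 : ℝ) ≤ √2 := by rw [Real.one_le_sqrt]; norm_num
  have h2b : √2 ≤ (2 : ℝ) := by rw [Real.sqrt_le_left (by norm_num)]; norm_num
  have hcl : 1 / √m ≤ c := by rw [hc1]; gcongr
  have hcu : c ≤ 2 / √m := by rw [hc1]; gcongr
  have hc0 : 0 < c := lt_of_lt_of_le (by positivity) hcl
  have hdist : |m - τ| ≤ A * √m := by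
    rw [abs_mul, abs_of_pos hc0] at hτ
    have : |m - τ| * (1 / √m) ≤ A := le_trans (by gcongr) hτ
    rwa [mul_one_div, div_le_iff₀ hs] at this
  have hdist' := abs_le.1 hdist
  have hDs : 2 * D ≤ √m := Real.le_sqrt_of_sq_le (by nlinarith)
  have hτ0 : 0 < τ := by nlinarith
  have hN1 := Nat.le_ceil τ
  have hN2 := Nat.ceil_lt_add_one hτ0.le
  set N := ⌈τ⌉₊
  have hbig : (D * (1 + D ^ 3) + 2 + 4) / √m = (D * (1 + D ^ 3) + 2) / √m + 2 * (2 / √m) := by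
    field_simp; ring
  rw [hbig]
  rcases le_total m N with hmN | hmN
  · obtain ⟨J, hJ⟩ := Nat.exists_eq_add_of_le hmN
    have hJ' : (N : ℝ) = m + J := by exact_mod_cast hJ
    have h1 := abs_binomTail_sub_normalCDF_le (A := D) (by positivity) hm1 hmD
      (J := J) (by rw [hD]; nlinarith)
    have h2 := abs_normalCDF_sub_le (-(J * c)) ((m - τ) * c)
    have h3 : |-(J * c) - (m - τ) * c| ≤ 2 * (2 / √m) := by
      rw [show -(J * c) - (m - τ) * c = -((J + m - τ) * c) by ring, abs_neg, abs_mul,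
        abs_of_pos hc0]
      have : |J + m - τ| ≤ 2 := by rw [abs_le]; constructor <;> linarith
      gcongr
    rw [hJ]
    calc _ ≤ |binomTail (2 * m) (m + J) - normalCDF (-(J * c))| +
          |normalCDF (-(J * c)) - normalCDF ((m - τ) * c)| := abs_sub_le _ _ _
      _ ≤ _ := by linarith
  -- A threshold N below the mean reflects to 2m + 1 - N = m + (m - N + 1), hence the value of J.
  · have hcast : (((m - N + 1 : ℕ)) : ℝ) = m - N + 1 := by push_cast [Nat.cast_sub hmN]; ring
    have h1 := abs_binomTail_sub_normalCDF_le (A := D) (by positivity) hm1 hmD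
      (J := m - N + 1) (by rw [hcast, hD]; nlinarith)
    have h2 := abs_normalCDF_sub_le ((m - N + 1 : ℕ) * c) ((m - τ) * c)
    have h3 : |((m - N + 1 : ℕ) : ℝ) * c - (m - τ) * c| ≤ 2 * (2 / √m) := by
      rw [← sub_mul, abs_mul, abs_of_pos hc0, hcast]
      have : |(m : ℝ) - N + 1 - (m - τ)| ≤ 2 := by rw [abs_le]; constructor <;> linarith
      gcongr
    have h4 := binomTail_add_binomTail (k := 2 * m) (N := N) (by omega)
    rw [show 2 * m + 1 - N = m + (m - N + 1) by omega] at h4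
    rw [normalCDF_neg] at h1
    have h5 := h2.trans h3
    rw [abs_le] at h1 h5 ⊢
    constructor <;> linarith

/-- Within A standard-deviation scales √m of the centre the Gaussian exponent is bounded, so each
atom is comparable to the central one. A single such atom will account for the drop of the mean fill
between consecutive levels. -/
theorem exists_le_binomProb_even (A : ℝ) :
    ∃ c : ℝ, 0 < c ∧ ∃ m₀ : ℕ, ∀ m ≥ m₀, ∀ j : ℕ, |(j : ℝ) - m| ≤ A * √m →
      c / √m ≤ binomProb (2 * m) j := by
  wlog hA : 0 ≤ A generalizing A
  · obtain ⟨c, hc, m₀, h⟩ := this 0 le_rfl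
    refine ⟨c, hc, m₀, fun m hm j hj => h m hm j (hj.trans ?_)⟩
    have := Real.sqrt_nonneg (m : ℝ)
    nlinarith
  obtain ⟨m₀, hm₀⟩ := exists_nat_ge (4 * A ^ 2)
  refine ⟨1 / 4 * Real.exp (-A ^ 2 - A ^ 3), by positivity, m₀ + 16, fun m hm j hj => ?_⟩
  have hm1 : 0 < m := by omega
  have hm' : (0 : ℝ) < m := by exact_mod_cast hm1
  have hmA : 4 * A ^ 2 ≤ m := hm₀.trans (by exact_mod_cast (by omega : m₀ ≤ m))
  have hs : (0 : ℝ) < √m := Real.sqrt_pos.2 hm'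
  have hs4 : 4 ≤ √(m : ℝ) := by
    apply Real.le_sqrt_of_sq_le
    have : (16 : ℝ) ≤ m := by exact_mod_cast (by omega : 16 ≤ m)
    linarith
  have hss : √(m : ℝ) * √m = m := Real.mul_self_sqrt hm'.le
  have key : ∀ i : ℕ, (i : ℝ) ≤ A * √m →
      1 / 4 * Real.exp (-A ^ 2 - A ^ 3) / √m ≤ binomProb (2 * m) (m + i) := by
    intro i hi
    refine le_trans ?_ (binomProb_gaussian_bounds hm1 i (two_mul_le_of_le_mul_sqrt hmA hi)).1
    have h1 : 1 / 4 / √m ≤ binomProb (2 * m) m := by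
      refine le_trans ?_ (le_binomProb_central hm1)
      have ha : 1 / 2 / √(m : ℝ) ≤ 1 / √(Real.pi * m) := by
        rw [Real.sqrt_mul Real.pi_pos.le, div_div]
        apply one_div_le_one_div_of_le (by have := Real.pi_pos; positivity)
        gcongr
        rw [Real.sqrt_le_left (by norm_num)]
        linarith [Real.pi_le_four]
      have hb : 1 / (m : ℝ) ≤ 1 / 4 / √m := by
        rw [div_div]
        apply one_div_le_one_div_of_le (by positivity)
        nlinarith
      have hc : 1 / 2 / √(m : ℝ) = 1 / 4 / √m + 1 / 4 / √m := by ring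
      linarith
    have h2 : Real.exp (-A ^ 2 - A ^ 3) ≤ Real.exp (-(i : ℝ) ^ 2 / m - (i : ℝ) ^ 3 / m ^ 2) := by
      apply Real.exp_le_exp.2
      have h3 := cube_div_sq_le hm1 hi
      have h4 : A ^ 3 / √m ≤ A ^ 3 := div_le_self (by positivity) (by linarith)
      have h5 : (i : ℝ) ^ 2 / m ≤ A ^ 2 := by
        rw [div_le_iff₀ hm', ← hss]
        nlinarith [show (0 : ℝ) ≤ i by positivity]
      rw [neg_div]
      linarith
    calc _ = 1 / 4 / √m * Real.exp (-A ^ 2 - A ^ 3) := by ring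
      _ ≤ _ := by
        have := binomProb_nonneg (2 * m) m
        gcongr
  rw [abs_le] at hj
  rcases le_total m j with h | h
  · obtain ⟨i, rfl⟩ := Nat.exists_eq_add_of_le h
    apply key
    push_cast at hj
    linarith
  · rw [← binomProb_symm (show j ≤ 2 * m by omega), show 2 * m - j = m + (m - j) by omega]
    apply key
    rw [Nat.cast_sub h]
    linarith

/-! ### The probability that at most one string falls in a cell -/

noncomputable section

/-- The probability that a binomial variable with parameters `n` and `x` is at most one. -/
def atMostOneProb (n : ℕ) (x : ℝ) : ℝ := (1 - x) ^ n + n * x * (1 - x) ^ (n - 1)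

end

theorem atMostOneProb_nonneg {n : ℕ} {x : ℝ} (h0 : 0 ≤ x) (h1 : x ≤ 1) :
    0 ≤ atMostOneProb n x := by
  have : 0 ≤ 1 - x := by linarith
  unfold atMostOneProb
  positivity

/-- Bernoulli's inequality, applied to each of the two terms. The bound is effective for small n x,
and `atMostOneProb_le_div` for large n x: together they express the switch from empty to filled near
n x = 1. -/
theorem one_sub_atMostOneProb_le {n : ℕ} {x : ℝ} (h0 : 0 ≤ x) (h1 : x ≤ 1) :
    1 - atMostOneProb n x ≤ (n * x) ^ 2 := by
  rcases Nat.eq_zero_or_pos n with rfl | hn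
  · simp [atMostOneProb]
  obtain ⟨N, rfl⟩ := Nat.exists_eq_succ_of_ne_zero hn.ne'
  have ha := one_add_mul_le_pow (show (-2 : ℝ) ≤ -x by linarith) (N + 1)
  have hb := one_add_mul_le_pow (show (-2 : ℝ) ≤ -x by linarith) N
  simp only [← sub_eq_add_neg] at ha hb
  unfold atMostOneProb
  simp only [Nat.succ_eq_add_one, Nat.add_sub_cancel]
  have hc : (((N + 1 : ℕ) : ℝ) * x) * (1 + N * -x) ≤ (((N + 1 : ℕ) : ℝ) * x) * (1 - x) ^ N := by
    gcongr
  push_cast at *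
  have hN : (0 : ℝ) ≤ N := by positivity
  nlinarith [mul_nonneg hN (mul_nonneg h0 h0), mul_nonneg h0 h0]

theorem atMostOneProb_le_div {n : ℕ} (hn : 2 ≤ n) {x : ℝ} (h0 : 0 < x) (h1 : x ≤ 1) :
    atMostOneProb n x ≤ 9 / (n * x) := by
  have hn0 : (2 : ℝ) ≤ n := by exact_mod_cast hn
  have hpow : ∀ N : ℕ, (1 - x) ^ N ≤ Real.exp (-(N * x)) := fun N => by
    have h : 1 - x ≤ Real.exp (-x) := by linarith [Real.add_one_le_exp (-x)]
    calc (1 - x) ^ N ≤ Real.exp (-x) ^ N := by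
          apply pow_le_pow_left₀ (by linarith) h
      _ = _ := by rw [← Real.exp_nat_mul]; ring_nf
  set y := (n : ℝ) * x with hy
  have hy0 : 0 < y := by positivity
  have ha : (1 - x) ^ n ≤ 1 / y := by
    refine (hpow n).trans ?_
    rw [Real.exp_neg, one_div]
    apply inv_anti₀ hy0
    linarith [Real.add_one_le_exp y]
  -- Since n ≥ 2, n - 1 ≥ n/2, so the power is at most exp(-y/2).
  have hb : y * (1 - x) ^ (n - 1) ≤ 8 / y := by
    have h2 : (1 - x) ^ (n - 1) ≤ Real.exp (-(y / 2)) := by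
      refine (hpow (n - 1)).trans ?_
      apply Real.exp_le_exp.2
      rw [Nat.cast_sub (by omega), hy]
      push_cast
      nlinarith
    have h3 : Real.exp (-(y / 2)) ≤ 8 / y ^ 2 := by
      rw [Real.exp_neg, inv_le_comm₀ (Real.exp_pos _) (by positivity), inv_div]
      have := Real.quadratic_le_exp_of_nonneg (show 0 ≤ y / 2 by positivity)
      nlinarith
    calc _ ≤ y * (8 / y ^ 2) := by gcongr; exact h2.trans h3
      _ = _ := by field_simp
  unfold atMostOneProb
  calc _ ≤ 1 / y + 8 / y := add_le_add ha hb
    _ = _ := by rw [← add_div]; norm_num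

/-- All terms but one cancel, leaving a derivative of constant sign on [0, 1]. The mean value
inequality then gives both monotonicity and a quantitative decrease. -/
theorem hasDerivAt_atMostOneProb (N : ℕ) (t : ℝ) :
    HasDerivAt (atMostOneProb (N + 2)) (-((N + 2) * (N + 1) * t * (1 - t) ^ N)) t := by
  have h1 : HasDerivAt (fun t : ℝ => 1 - t) (-1) t := by
    simpa using (hasDerivAt_id t).const_sub 1
  have h2 := (h1.fun_pow (N + 2)).add
    (((hasDerivAt_id t).const_mul ((N + 2 : ℕ) : ℝ)).mul (h1.fun_pow (N + 1)))
  refine (h2.congr_deriv ?_).congr_of_eventuallyEq (Eventually.of_forall fun y => ?_)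
  · simp only [id, show N + 2 - 1 = N + 1 by omega, Nat.add_sub_cancel, mul_one]
    push_cast
    ring
  · simp only [atMostOneProb, id, Pi.add_apply, Pi.mul_apply, show N + 2 - 1 = N + 1 by omega]

theorem le_atMostOneProb_sub {n : ℕ} (hn : 2 ≤ n) {a b : ℝ} (h0 : 0 ≤ a) (hab : a ≤ b)
    (h1 : b ≤ 1) :
    n * (n - 1) * a * (1 - b) ^ (n - 2) * (b - a) ≤ atMostOneProb n a - atMostOneProb n b := by
  obtain ⟨N, rfl⟩ := Nat.exists_eq_add_of_le' hn
  have hd : ∀ t, HasDerivAt (fun t => -atMostOneProb (N + 2) t)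
      ((N + 2) * (N + 1) * t * (1 - t) ^ N) t := fun t => by
    have := (hasDerivAt_atMostOneProb N t).fun_neg
    rwa [neg_neg] at this
  have h := (convex_Icc a b).mul_sub_le_image_sub_of_le_deriv
    (f := fun t => -atMostOneProb (N + 2) t)
    (fun t _ => (hd t).continuousAt.continuousWithinAt)
    (fun t _ => (hd t).differentiableAt.differentiableWithinAt)
    (C := (N + 2) * (N + 1) * a * (1 - b) ^ N)
    (fun t ht => by
      rw [interior_Icc] at ht
      rw [(hd t).deriv]
      have : (1 - b) ^ N ≤ (1 - t) ^ N :=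
        pow_le_pow_left₀ (by linarith) (by linarith [ht.2]) N
      have ht1 := ht.1.le
      have : 0 ≤ (1 - b) ^ N := pow_nonneg (by linarith) N
      have : 0 ≤ t := h0.trans ht1
      gcongr) a (Set.left_mem_Icc.2 hab) b (Set.right_mem_Icc.2 hab) hab
  push_cast
  have e : ((N : ℝ) + 2 - 1) = N + 1 := by ring
  rw [e]
  linarith

theorem atMostOneProb_antitone {n : ℕ} (hn : 2 ≤ n) {a b : ℝ} (h0 : 0 ≤ a) (hab : a ≤ b)
    (h1 : b ≤ 1) : atMostOneProb n b ≤ atMostOneProb n a := by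
  have h := le_atMostOneProb_sub hn h0 hab h1
  have hn0 : (2 : ℝ) ≤ n := by exact_mod_cast hn
  have : 0 ≤ (n : ℝ) * (n - 1) * a * (1 - b) ^ (n - 2) * (b - a) := by
    have e1 : (0 : ℝ) ≤ n - 1 := by linarith
    have e2 : 0 ≤ 1 - b := by linarith
    have e3 : 0 ≤ b - a := by linarith
    positivity
  linarith

/-- Passing from a cell of expected size of order one to a proportional subcell increases the
probability of containing at most one string by a constant. -/
theorem le_atMostOneProb_mul_sub {n : ℕ} {q x y₀ y₁ : ℝ} (hq0 : 0 ≤ q) (hq1 : q ≤ 1)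
    (hy₀ : 0 ≤ y₀) (hl : y₀ ≤ n * x) (hu : n * x ≤ y₁) (hx0 : 0 ≤ x) (hn : 2 ≤ n)
    (hn' : 2 * y₁ ≤ n) :
    q * (1 - q) * (y₀ ^ 2 / 2 * Real.exp (-(2 * y₁))) ≤
      atMostOneProb n (q * x) - atMostOneProb n x := by
  have hn0 : (2 : ℝ) ≤ n := by exact_mod_cast hn
  have hx1 : x ≤ 1 / 2 := by
    have : (n : ℝ) * x ≤ n * (1 / 2) := by linarith
    exact le_of_mul_le_mul_left this (by linarith)
  have hqx : q * x ≤ x := by nlinarith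
  refine le_trans ?_ (le_atMostOneProb_sub hn (by positivity) hqx (by linarith))
  have h1 : Real.exp (-(2 * y₁)) ≤ (1 - x) ^ (n - 2) := by
    calc Real.exp (-(2 * y₁)) ≤ Real.exp ((n : ℝ) * (-x - x ^ 2)) := by
          apply Real.exp_le_exp.2
          have : x ^ 2 ≤ x := by nlinarith
          have : (n : ℝ) * x ^ 2 ≤ n * x := by gcongr
          nlinarith
      _ = Real.exp (-x - x ^ 2) ^ n := Real.exp_nat_mul _ _
      _ ≤ (1 - x) ^ n := by
          apply pow_le_pow_left₀ (Real.exp_nonneg _) (exp_neg_sub_sq_le_one_sub hx0 hx1)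
      _ ≤ _ := pow_le_pow_of_le_one (by linarith) (by linarith) (by omega)
  have h2 : y₀ ^ 2 / 2 ≤ (n : ℝ) * (n - 1) * x ^ 2 := by
    have : y₀ ^ 2 ≤ (n * x) ^ 2 := by gcongr
    have : (n : ℝ) ^ 2 ≤ 2 * (n * (n - 1)) := by nlinarith
    have : (n : ℝ) ^ 2 * x ^ 2 ≤ 2 * (n * (n - 1)) * x ^ 2 := by gcongr
    nlinarith
  have e1 : 0 ≤ 1 - q := by linarith
  have e2 : 0 ≤ (n : ℝ) * (n - 1) * x ^ 2 := le_trans (by positivity) h2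
  calc _ ≤ q * (1 - q) * ((n : ℝ) * (n - 1) * x ^ 2 * (1 - x) ^ (n - 2)) := by gcongr
    _ = _ := by ring

/-! ### Binomial averages over the cells of a level -/

noncomputable section

/-- The average of `f` over the probabilities of the `2 ^ k` words of length `k`. -/
def cellAverage (p q : ℝ) (k : ℕ) (f : ℝ → ℝ) : ℝ :=
  ∑ ij ∈ Finset.HasAntidiagonal.antidiagonal k,
    (k.choose ij.1 : ℝ) * f (p ^ ij.1 * q ^ ij.2) / 2 ^ k

/-- The expected proportion of filled nodes at level `k` of a trie built from `n` strings. -/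
def meanFill (p q : ℝ) (n k : ℕ) : ℝ := cellAverage p q k fun x => 1 - atMostOneProb n x

end

/-- The antidiagonal form of the definition suits the exchange of p and q and Pascal's rule; this
form suits comparison with binomial tails. -/
theorem cellAverage_eq_sum_range (p q : ℝ) (k : ℕ) (f : ℝ → ℝ) :
    cellAverage p q k f =
      ∑ j ∈ Finset.range (k + 1), binomProb k j * f (p ^ j * q ^ (k - j)) := by
  rw [cellAverage, Finset.Nat.sum_antidiagonal_eq_sum_range_succ
    (fun i j => (k.choose i : ℝ) * f (p ^ i * q ^ j) / 2 ^ k)]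
  refine Finset.sum_congr rfl fun j _ => ?_
  rw [binomProb]; ring

theorem cellAverage_comm (p q : ℝ) (k : ℕ) (f : ℝ → ℝ) :
    cellAverage p q k f = cellAverage q p k f := by
  rw [cellAverage, ← Finset.Nat.sum_antidiagonal_swap, cellAverage]
  refine Finset.sum_congr rfl fun ij hij => ?_
  rw [Finset.HasAntidiagonal.mem_antidiagonal] at hij
  have : k.choose ij.2 = k.choose ij.1 := by
    rw [← hij]; exact (Nat.choose_symm_add).symm
  simp only [Prod.fst_swap, Prod.snd_swap, this, mul_comm]

theorem meanFill_comm (p q : ℝ) (n k : ℕ) : meanFill p q n k = meanFill q p n k :=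
  cellAverage_comm _ _ _ _

/-- A cell of probability x splits into children of probabilities p x and q x; on multiplicities
this is Pascal's rule. -/
theorem cellAverage_succ (p q : ℝ) (k : ℕ) (f : ℝ → ℝ) :
    cellAverage p q (k + 1) f = cellAverage p q k fun x => (f (p * x) + f (q * x)) / 2 := by
  simp only [cellAverage, ← Finset.sum_div]
  rw [Finset.sum_antidiagonal_choose_succ_mul (fun i j => f (p ^ i * q ^ j)), pow_succ,
    ← Finset.sum_add_distrib, div_eq_div_iff (by positivity) (by positivity), ← mul_assoc,
    mul_right_comm]
  congr 1
  rw [Finset.sum_mul]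
  refine Finset.sum_congr rfl fun ij hij => ?_
  rw [Finset.HasAntidiagonal.mem_antidiagonal] at hij
  have : k.choose ij.2 = k.choose ij.1 := by
    rw [← hij]; exact (Nat.choose_symm_add).symm
  rw [this, pow_succ, pow_succ, show p ^ ij.1 * (q ^ ij.2 * q) = q * (p ^ ij.1 * q ^ ij.2) by ring,
    show p ^ ij.1 * p * q ^ ij.2 = p * (p ^ ij.1 * q ^ ij.2) by ring]
  ring

theorem cellProb_nonneg {p q : ℝ} (hp : 0 ≤ p) (hq : 0 ≤ q) (i j : ℕ) : 0 ≤ p ^ i * q ^ j := by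
  positivity

theorem cellProb_le_one {p q : ℝ} (hp : 0 ≤ p) (hq : 0 ≤ q) (hpq : p + q = 1) (i j : ℕ) :
    p ^ i * q ^ j ≤ 1 :=
  mul_le_one₀ (pow_le_one₀ hp (by linarith)) (by positivity) (pow_le_one₀ hq (by linarith))

/-- The mean proportion of filled nodes lost from one level to the next. -/
theorem meanFill_sub_succ (p q : ℝ) (n k : ℕ) :
    meanFill p q n k - meanFill p q n (k + 1) =
      ∑ j ∈ Finset.range (k + 1), binomProb k j *
        ((atMostOneProb n (p * (p ^ j * q ^ (k - j))) - atMostOneProb n (p ^ j * q ^ (k - j))) / 2 +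
         (atMostOneProb n (q * (p ^ j * q ^ (k - j))) - atMostOneProb n (p ^ j * q ^ (k - j))) / 2)
      := by
  rw [meanFill, meanFill, cellAverage_succ, cellAverage_eq_sum_range, cellAverage_eq_sum_range,
    ← Finset.sum_sub_distrib]
  refine Finset.sum_congr rfl fun j _ => ?_
  ring

/-- The two children are treated separately so that the total drop can be bounded below by one child
of a single class of cells. -/
theorem meanFill_sub_succ_terms_nonneg {p q : ℝ} (hp : 0 ≤ p) (hq : 0 ≤ q) (hpq : p + q = 1)
    {n : ℕ} (hn : 2 ≤ n) (i j : ℕ) :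
    0 ≤ (atMostOneProb n (p * (p ^ i * q ^ j)) - atMostOneProb n (p ^ i * q ^ j)) / 2 ∧
    0 ≤ (atMostOneProb n (q * (p ^ i * q ^ j)) - atMostOneProb n (p ^ i * q ^ j)) / 2 := by
  have h0 := cellProb_nonneg hp hq i j
  have h1 := cellProb_le_one hp hq hpq i j
  set x := p ^ i * q ^ j
  have ha := atMostOneProb_antitone hn (mul_nonneg hp h0)
    (show p * x ≤ x from mul_le_of_le_one_left h0 (by linarith)) h1
  have hb := atMostOneProb_antitone hn (mul_nonneg hq h0)
    (show q * x ≤ x from mul_le_of_le_one_left h0 (by linarith)) h1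
  constructor <;> linarith

theorem meanFill_antitone {p q : ℝ} (hp : 0 ≤ p) (hq : 0 ≤ q) (hpq : p + q = 1) {n : ℕ}
    (hn : 2 ≤ n) : Antitone (meanFill p q n) := by
  apply antitone_nat_of_succ_le
  intro k
  rw [← sub_nonneg, meanFill_sub_succ]
  refine Finset.sum_nonneg fun j _ => mul_nonneg (binomProb_nonneg _ _) ?_
  have := meanFill_sub_succ_terms_nonneg hp hq hpq hn j (k - j)
  linarith

/-! ### Normal approximation of the mean -/

noncomputable section

/-- The (real) number of ones at which the probability of a word of length `k` equals `1 / n`. -/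
def cellThreshold (p q : ℝ) (n k : ℕ) : ℝ :=
  (-(k * Real.log q) - Real.log n) / Real.log (p / q)

end

/-- The expected occupancy of a cell is geometric in the number of ones, with ratio p/q > 1. This is
where bias makes the transition between empty and filled cells sharp. -/
theorem mul_cellProb_eq_exp {p q : ℝ} (hq : 0 < q) (hqp : q < p) {n : ℕ} (hn : 0 < n) {j k : ℕ}
    (hj : j ≤ k) :
    n * (p ^ j * q ^ (k - j)) =
      Real.exp (Real.log (p / q) * (j - cellThreshold p q n k)) := by
  have hp : 0 < p := hq.trans hqp
  have hn' : (0 : ℝ) < n := by exact_mod_cast hn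
  have hlam : 0 < Real.log (p / q) := Real.log_pos (by rwa [one_lt_div hq])
  have h : Real.log (p / q) * (j - cellThreshold p q n k) =
      Real.log n + (j * Real.log p + ((k - j : ℕ) : ℝ) * Real.log q) := by
    rw [cellThreshold, mul_sub, mul_div_cancel₀ _ hlam.ne', Real.log_div hp.ne' hq.ne',
      Nat.cast_sub hj]
    ring
  rw [h, Real.exp_add, Real.exp_add, Real.exp_log hn', Real.exp_nat_mul, Real.exp_nat_mul,
    Real.exp_log hp, Real.exp_log hq]

theorem geom_partial_sum_le {r : ℝ} (h0 : 0 ≤ r) (h1 : r < 1) (K : ℕ) :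
    ∑ i ∈ Finset.range K, r ^ i ≤ (1 - r)⁻¹ := by
  rw [← tsum_geometric_of_lt_one h0 h1]
  exact (summable_geometric_of_lt_one h0 h1).sum_le_tsum _ fun i _ => pow_nonneg h0 i

theorem sum_exp_abs_sub_le {lam : ℝ} (hlam : 0 < lam) (τ : ℝ) (K : ℕ) :
    ∑ j ∈ Finset.range K, Real.exp (-(lam * |(j : ℝ) - τ|)) ≤ 2 * (1 - Real.exp (-lam))⁻¹ := by
  set r := Real.exp (-lam) with hr
  have hr0 : 0 ≤ r := Real.exp_nonneg _
  have hr1 : r < 1 := Real.exp_zero ▸ Real.exp_lt_exp.2 (by linarith)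
  have hpow : ∀ i : ℕ, r ^ i = Real.exp (-(lam * i)) := fun i => by
    rw [hr, ← Real.exp_nat_mul]; ring_nf
  set N := ⌈τ⌉₊ with hN
  -- Enlarging the range to N + K allows a split at N = ⌈τ⌉ wherever τ lies; each side is then
  -- dominated by a geometric series.
  have hle : ∑ j ∈ Finset.range K, Real.exp (-(lam * |(j : ℝ) - τ|)) ≤
      ∑ j ∈ Finset.range (N + K), Real.exp (-(lam * |(j : ℝ) - τ|)) :=
    Finset.sum_le_sum_of_subset_of_nonneg (Finset.range_mono (by omega))
      fun _ _ _ => Real.exp_nonneg _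
  rw [Finset.sum_range_add] at hle
  have h1 : ∑ j ∈ Finset.range N, Real.exp (-(lam * |(j : ℝ) - τ|)) ≤
      ∑ j ∈ Finset.range N, r ^ (N - 1 - j) := by
    refine Finset.sum_le_sum fun j hj => ?_
    have hj' := Finset.mem_range.1 hj
    rw [hpow]
    apply Real.exp_le_exp.2
    have hτ : (j : ℝ) < τ := Nat.lt_ceil.1 hj'
    have hτ0 : 0 ≤ τ := le_trans (by positivity) hτ.le
    have hN1 := Nat.ceil_lt_add_one hτ0
    rw [abs_of_neg (by linarith)]
    have hc : ((N - 1 - j : ℕ) : ℝ) = N - 1 - j := by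
      rw [Nat.cast_sub (by omega), Nat.cast_sub (by omega)]; simp
    rw [hc]
    nlinarith
  have h2 : ∑ i ∈ Finset.range K, Real.exp (-(lam * |((N + i : ℕ) : ℝ) - τ|)) ≤
      ∑ i ∈ Finset.range K, r ^ i := by
    refine Finset.sum_le_sum fun i _ => ?_
    rw [hpow]
    apply Real.exp_le_exp.2
    have := Nat.le_ceil τ
    have hi : (i : ℝ) ≤ ((N + i : ℕ) : ℝ) - τ := by push_cast; linarith
    have := hi.trans (le_abs_self _)
    nlinarith
  rw [Finset.sum_range_reflect] at h1
  have h3 := geom_partial_sum_le hr0 hr1 N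
  have h4 := geom_partial_sum_le hr0 hr1 K
  linarith

/-- The filling probability differs from the indicator of j ≥ τ by at most 9 exp(-λ|j - τ|). These
errors have a bounded sum, and each is weighted by an atom of size at most 1/√m. -/
theorem abs_meanFill_sub_binomTail_le {p q : ℝ} (hq : 0 < q) (hqp : q < p) (hpq : p + q = 1)
    {n m : ℕ} (hn : 2 ≤ n) (hm : 0 < m) :
    |meanFill p q n (2 * m) - binomTail (2 * m) ⌈cellThreshold p q n (2 * m)⌉₊| ≤
      18 * (1 - Real.exp (-Real.log (p / q)))⁻¹ / √m := by
  have hp : 0 < p := hq.trans hqp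
  have hlam : 0 < Real.log (p / q) := Real.log_pos (by rwa [one_lt_div hq])
  set lam := Real.log (p / q) with hlamdef
  set τ := cellThreshold p q n (2 * m) with hτdef
  have htail : binomTail (2 * m) ⌈τ⌉₊ =
      ∑ j ∈ Finset.range (2 * m + 1), binomProb (2 * m) j * (if τ ≤ j then 1 else 0) := by
    rw [binomTail]
    simp only [mul_ite, mul_one, mul_zero]
    rw [← Finset.sum_filter]
    refine Finset.sum_congr ?_ fun _ _ => rfl
    ext j
    simp only [Finset.mem_Ico, Finset.mem_filter, Finset.mem_range, Nat.ceil_le]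
    tauto
  rw [meanFill, cellAverage_eq_sum_range, htail, ← Finset.sum_sub_distrib]
  refine (Finset.abs_sum_le_sum_abs _ _).trans ?_
  have hterm : ∀ j ∈ Finset.range (2 * m + 1),
      |binomProb (2 * m) j * (1 - atMostOneProb n (p ^ j * q ^ (2 * m - j))) -
        binomProb (2 * m) j * (if τ ≤ j then 1 else 0)| ≤
      1 / √m * (9 * Real.exp (-(lam * |(j : ℝ) - τ|))) := by
    intro j hj
    have hj' : j ≤ 2 * m := by have := Finset.mem_range.1 hj; omega
    have hexp := mul_cellProb_eq_exp hq hqp (show 0 < n by omega) hj'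
    rw [← hτdef, ← hlamdef] at hexp
    have hx0 : 0 < p ^ j * q ^ (2 * m - j) := by positivity
    have hx1 := cellProb_le_one hp.le hq.le hpq j (2 * m - j)
    set x := p ^ j * q ^ (2 * m - j)
    rw [← mul_sub, abs_mul, abs_of_nonneg (binomProb_nonneg _ _)]
    have hup := one_sub_atMostOneProb_le (n := n) hx0.le hx1
    have hlo := atMostOneProb_le_div hn hx0 hx1
    have hnn := atMostOneProb_nonneg (n := n) hx0.le hx1
    have hle1 : atMostOneProb n x ≤ 1 := by
      have := atMostOneProb_antitone hn le_rfl hx0.le hx1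
      refine this.trans ?_
      simp [atMostOneProb]
    apply mul_le_mul (binomProb_even_le hm j) _ (abs_nonneg _) (by positivity)
    rw [hexp] at hup hlo
    split_ifs with h
    · rw [sub_sub_cancel_left, abs_neg, abs_of_nonneg hnn, abs_of_nonneg (sub_nonneg.2 h),
        Real.exp_neg]
      exact hlo
    · push Not at h
      rw [sub_zero, abs_of_nonneg (by linarith), abs_of_neg (by linarith)]
      refine hup.trans ?_
      rw [mul_neg, neg_neg]
      have h1 : Real.exp (lam * (j - τ)) ≤ 1 := Real.exp_le_one_iff.2 (by nlinarith)
      have h2 := Real.exp_pos (lam * (j - τ))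
      nlinarith
  refine (Finset.sum_le_sum hterm).trans ?_
  rw [← Finset.mul_sum, ← Finset.mul_sum]
  have := sum_exp_abs_sub_le hlam τ (2 * m + 1)
  calc _ ≤ 1 / √(m : ℝ) * (9 * (2 * (1 - Real.exp (-lam))⁻¹)) := by gcongr
    _ = _ := by ring

noncomputable section

/-- The rate at which the logarithm of a typical cell probability decreases with the level. -/
def levelRate (p q : ℝ) : ℝ := Real.log (1 / √(p * q))

end

theorem levelRate_eq {p q : ℝ} (hp : 0 < p) (hq : 0 < q) :
    levelRate p q = -(Real.log p + Real.log q) / 2 := by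
  rw [levelRate, one_div, Real.log_inv, Real.log_sqrt (by positivity), Real.log_mul hp.ne' hq.ne']
  ring

theorem levelRate_pos {p q : ℝ} (hp : 0 < p) (hq : 0 < q) (hpq : p + q = 1) :
    0 < levelRate p q := by
  rw [levelRate_eq hp hq]
  have h1 := Real.log_neg hp (by linarith)
  have h2 := Real.log_neg hq (by linarith)
  linarith

/-- Centring the threshold at the binomial mean k/2 exhibits the deviation that is standardized in
the normal approximation. -/
theorem cellThreshold_eq {p q : ℝ} (hq : 0 < q) (hqp : q < p) (n k : ℕ) :
    cellThreshold p q n k = k / 2 - (Real.log n - k * levelRate p q) / Real.log (p / q) := by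
  have hp : 0 < p := hq.trans hqp
  have hlam : 0 < Real.log (p / q) := Real.log_pos (by rwa [one_lt_div hq])
  rw [levelRate_eq hp hq, cellThreshold]
  field_simp
  rw [Real.log_div hp.ne' hq.ne']
  ring

/-- Normal approximation of the expected proportion of filled nodes at even levels. -/
theorem exists_abs_meanFill_sub_normalCDF_le {p q : ℝ} (hq : 0 < q) (hqp : q < p)
    (hpq : p + q = 1) (A : ℝ) :
    ∃ C : ℝ, 0 < C ∧ ∃ m₀ : ℕ, ∀ m ≥ m₀, ∀ n : ℕ, 2 ≤ n → ∀ z : ℝ,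
      z = (Real.log n - (2 * m : ℕ) * levelRate p q) / Real.log (p / q) * √(2 / m) → |z| ≤ A →
      |meanFill p q n (2 * m) - normalCDF z| ≤ C / √m := by
  obtain ⟨C, hC, m₀, h⟩ := exists_abs_binomTail_ceil_sub_normalCDF_le A
  have hlam : 0 < Real.log (p / q) := Real.log_pos (by rwa [one_lt_div hq])
  have hr1 : Real.exp (-Real.log (p / q)) < 1 := Real.exp_zero ▸ Real.exp_lt_exp.2 (by linarith)
  have hr2 : 0 < (1 - Real.exp (-Real.log (p / q)))⁻¹ := inv_pos.2 (by linarith)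
  refine ⟨C + 18 * (1 - Real.exp (-Real.log (p / q)))⁻¹, by positivity, m₀ + 1,
    fun m hm n hn z hz hzA => ?_⟩
  have h1 := abs_meanFill_sub_binomTail_le hq hqp hpq hn (show 0 < m by omega)
  -- The factor √(2/m) is the inverse of the standard deviation of 2m fair trials.
  have hz' : z = (m - cellThreshold p q n (2 * m)) * √(2 / m) := by
    rw [hz, cellThreshold_eq hq hqp]
    push_cast
    ring
  have h2 := h m (by omega) (cellThreshold p q n (2 * m)) (by rwa [← hz'])
  rw [← hz'] at h2
  rw [add_div, add_comm (C / √m)]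
  exact (abs_sub_le _ _ _).trans (add_le_add h1 h2)

/-- Near the critical level, the expected proportion of filled nodes drops at each step by at least
a constant over the square root of the level. -/
theorem exists_le_meanFill_sub_succ {p q : ℝ} (hq : 0 < q) (hqp : q < p) (hpq : p + q = 1)
    (A : ℝ) (hA : 0 ≤ A) :
    ∃ c : ℝ, 0 < c ∧ ∃ k₀ : ℕ, ∀ k ≥ k₀, ∀ n ≥ k₀,
      |Real.log n - k * levelRate p q| ≤ A * √k →
      c / √k ≤ meanFill p q n k - meanFill p q n (k + 1) := by
  have hp : 0 < p := hq.trans hqp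
  have hlam : 0 < Real.log (p / q) := Real.log_pos (by rwa [one_lt_div hq])
  set lam := Real.log (p / q) with hlamdef
  set D := A / lam with hD
  have hD0 : 0 ≤ D := by positivity
  obtain ⟨c, hc, m₀, h⟩ := exists_le_binomProb_even (2 * D + 2)
  obtain ⟨k₁, hk₁⟩ := exists_nat_ge ((2 * D + 2) ^ 2)
  obtain ⟨k₂, hk₂⟩ := exists_nat_ge (2 * (p / q))
  set b := q * (1 - q) * (1 ^ 2 / 2 * Real.exp (-(2 * (p / q)))) with hb
  have hb0 : 0 < b := by
    have : 0 < 1 - q := by linarith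
    positivity
  refine ⟨c / 2 * (b / 2), by positivity, 2 * m₀ + 2 + k₁ + k₂, fun k hk n hn hkn => ?_⟩
  have hk0 : (0 : ℝ) < k := by exact_mod_cast (by omega : 0 < k)
  have hk1 : (1 : ℝ) ≤ k := by exact_mod_cast (by omega : 1 ≤ k)
  have hτ := cellThreshold_eq hq hqp n k
  rw [← hlamdef] at hτ
  set τ := cellThreshold p q n k with hτdef
  have hdist : |k / 2 - τ| ≤ D * √k := by
    rw [hτ, sub_sub_cancel, abs_div, abs_of_pos hlam, hD, div_mul_eq_mul_div]
    gcongr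
  have hsk : √(k : ℝ) * √k = k := Real.mul_self_sqrt hk0.le
  have hsk2 : 2 * D + 2 ≤ √(k : ℝ) := by
    apply Real.le_sqrt_of_sq_le
    exact hk₁.trans (by exact_mod_cast (by omega : k₁ ≤ k))
  have hd := abs_le.1 hdist
  have hτ0 : 0 < τ := by nlinarith
  have hj1 := Nat.le_ceil τ
  have hj2 := Nat.ceil_lt_add_one hτ0.le
  -- Cells with j ones lie just above the threshold: their expected occupancy is between 1 and p/q.
  -- Passing to the child of relative probability q lowers the filling probability by at least the
  -- constant b.
  set j := ⌈τ⌉₊ with hj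
  have hjk : j ≤ k := by
    have : (j : ℝ) ≤ k := by nlinarith
    exact_mod_cast this
  obtain ⟨m, hm⟩ : ∃ m, m = k / 2 := ⟨_, rfl⟩
  have hm1 : (1 : ℝ) ≤ m := by exact_mod_cast (by omega : 1 ≤ m)
  have hmk : (2 * m : ℝ) ≤ k := by exact_mod_cast (by omega : 2 * m ≤ k)
  have hkm : (k : ℝ) ≤ 2 * m + 1 := by exact_mod_cast (by omega : k ≤ 2 * m + 1)
  have hsm1 : 1 ≤ √(m : ℝ) := by rwa [Real.one_le_sqrt]
  have hskm : √(k : ℝ) ≤ 2 * √m := by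
    rw [Real.sqrt_le_left (by positivity), mul_pow, Real.sq_sqrt (by linarith)]
    linarith
  have hloc := h m (by omega) j (by
    rw [abs_le]
    constructor <;> nlinarith)
  have hB : c / 2 / √k ≤ binomProb k j := by
    have h1 : c / 2 / √k ≤ binomProb (2 * m) j / 2 := by
      rw [div_right_comm]
      have : c / √k ≤ c / √m := by
        gcongr
        exact_mod_cast (by omega : m ≤ k)
      linarith
    -- An odd level costs a factor 2 relative to the even level below it, already allowed for in c /
    -- 2.
    rcases Nat.even_or_odd' k with ⟨m', hk' | hk'⟩
    · have : k = 2 * m := by omega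
      rw [this] at h1 ⊢
      have := binomProb_nonneg (2 * m) j
      linarith
    · have : k = 2 * m + 1 := by omega
      have h2 := half_binomProb_le_succ (2 * m) j
      rw [← this] at h2
      linarith
  have hn2 : 2 ≤ n := by omega
  have hexp := mul_cellProb_eq_exp hq hqp (show 0 < n by omega) hjk
  rw [← hτdef, ← hlamdef] at hexp
  have hy1 : 1 ≤ (n : ℝ) * (p ^ j * q ^ (k - j)) := by
    rw [hexp]
    exact Real.one_le_exp (mul_nonneg hlam.le (sub_nonneg.2 hj1))
  have hy2 : (n : ℝ) * (p ^ j * q ^ (k - j)) ≤ p / q := by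
    rw [hexp, ← Real.exp_log (show 0 < p / q by positivity), ← hlamdef]
    exact Real.exp_le_exp.2 (mul_le_of_le_one_right hlam.le (by linarith))
  have hdec := le_atMostOneProb_mul_sub hq.le (by linarith) zero_le_one hy1 hy2
    (by positivity) hn2 (hk₂.trans (by exact_mod_cast (by omega : k₂ ≤ n)))
  rw [← hb] at hdec
  rw [meanFill_sub_succ]
  refine le_trans ?_ (Finset.single_le_sum (fun i _ => mul_nonneg (binomProb_nonneg k i) ?_)
    (Finset.mem_range.2 (show j < k + 1 by omega)))
  · have := (meanFill_sub_succ_terms_nonneg hp.le hq.le hpq hn2 j (k - j)).1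
    calc c / 2 * (b / 2) / √k = c / 2 / √k * (b / 2) := by ring
      _ ≤ _ := by
        apply mul_le_mul hB _ (by positivity) (binomProb_nonneg _ _)
        linarith
  · have := meanFill_sub_succ_terms_nonneg hp.le hq.le hpq hn2 i (k - i)
    linarith

/-! ### The critical level -/

noncomputable section

/-- The real level around which the expected proportion of filled nodes crosses the value whose
normal quantile is `a`. -/
def criticalLevel (p q a : ℝ) (n : ℕ) : ℝ :=
  Real.logb (1 / √(p * q)) n -
    |Real.log (p / q)| / (2 * Real.log (1 / √(p * q)) ^ (3 / 2 : ℝ)) * a * √(Real.log n)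

end

theorem criticalLevel_comm {p q : ℝ} (a : ℝ) (n : ℕ) :
    criticalLevel p q a n = criticalLevel q p a n := by
  rw [criticalLevel, criticalLevel, mul_comm p q, ← inv_div q p, Real.log_inv, abs_neg]

/-- In terms of s = √(ln n) the critical level is the polynomial s²/L - c₀s; later estimates are
algebra in s. -/
theorem criticalLevel_eq {p q : ℝ} (hq : 0 < q) (hqp : q < p) (hpq : p + q = 1) (a : ℝ) (n : ℕ) :
    criticalLevel p q a n = √(Real.log n) ^ 2 / levelRate p q -
      Real.log (p / q) / (2 * (levelRate p q * √(levelRate p q))) * a * √(Real.log n) := by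
  have hlam : 0 < Real.log (p / q) := Real.log_pos (by rwa [one_lt_div hq])
  have hL := levelRate_pos (hq.trans hqp) hq hpq
  have h32 : levelRate p q ^ (3 / 2 : ℝ) = levelRate p q * √(levelRate p q) := by
    rw [show (3 / 2 : ℝ) = 1 + 1 / 2 by norm_num, Real.rpow_add hL, Real.rpow_one,
      Real.sqrt_eq_rpow]
  rw [criticalLevel, Real.logb, ← levelRate, abs_of_pos hlam, h32,
    Real.sq_sqrt (Real.log_natCast_nonneg n)]

theorem eventually_le_sqrt_log (S : ℝ) : ∀ᶠ n : ℕ in atTop, S ≤ √(Real.log n) :=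
  ((Real.tendsto_sqrt_atTop.comp Real.tendsto_log_atTop).comp
    tendsto_natCast_atTop_atTop).eventually_ge_atTop S

section levels

variable {L lam a T s k c₀ : ℝ}

/-- With s² = ln n, levels near the critical one have ln n - kL = O(s): the threshold stays within a
bounded number of standard deviations of the mean. -/
theorem abs_sq_sub_mul_le (hL : 0 < L) (hT : T ≤ s) (ht : |k - (s ^ 2 / L - c₀ * s)| ≤ T) :
    |s ^ 2 - k * L| ≤ L * (|c₀| + 1) * s := by
  have hs0 : 0 ≤ s := (abs_nonneg _).trans (ht.trans hT)
  have h1 : s ^ 2 - k * L = L * (c₀ * s - (k - (s ^ 2 / L - c₀ * s))) := by field_simp; ring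
  rw [h1, abs_mul, abs_of_pos hL, mul_assoc]
  gcongr
  calc _ ≤ |c₀ * s| + |k - (s ^ 2 / L - c₀ * s)| := abs_sub _ _
    _ ≤ |c₀| * s + s := by rw [abs_mul, abs_of_nonneg hs0]; linarith
    _ = _ := by ring

theorem level_bounds (hL : 0 < L) (hT : T ≤ s) (hs : 2 * (L * (|c₀| + 1)) ≤ s)
    (ht : |k - (s ^ 2 / L - c₀ * s)| ≤ T) : s ^ 2 / (2 * L) ≤ k ∧ k ≤ 2 * s ^ 2 / L := by
  have hs0 : 0 ≤ s := (abs_nonneg _).trans (ht.trans hT)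
  have h := abs_le.1 (abs_sq_sub_mul_le hL hT ht)
  have h2 : L * (|c₀| + 1) * s ≤ s ^ 2 / 2 := by nlinarith
  constructor
  · rw [div_le_iff₀ (by positivity)]; linarith
  · rw [le_div_iff₀ hL]; nlinarith [sq_nonneg s]

/-- This explains the second-order term of the critical level. With t the offset from it and ρ =
s/√(kL), the value of c₀ makes the standardized deviation exactly aρ - (2L/λ)t/√k, and ρ - 1 =
O(1/s). -/
theorem abs_standardized_level_sub_le (hL : 0 < L) (hlam : 0 < lam) (hs0 : 0 < s)
    (hc₀ : c₀ = lam / (2 * (L * √L)) * a) (hT : T ≤ s)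
    (hs : 2 * (L * (|c₀| + 1)) ≤ s) (ht : |k - (s ^ 2 / L - c₀ * s)| ≤ T) :
    |(s ^ 2 - k * L) / lam * (2 / √k) -
        (a - 2 * L / lam * (k - (s ^ 2 / L - c₀ * s)) / √k)| ≤
      |a| * (2 * (L * (|c₀| + 1))) / s := by
  have hb := level_bounds hL hT hs ht
  have hk0 : 0 < k := lt_of_lt_of_le (by positivity) hb.1
  have hsk : 0 < √k := Real.sqrt_pos.2 hk0
  have hsL : 0 < √L := Real.sqrt_pos.2 hL
  have hsL2 : √L ^ 2 = L := Real.sq_sqrt hL.le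
  have hsk2 : √k ^ 2 = k := Real.sq_sqrt hk0.le
  set ρ := s / (√L * √k) with hρ
  have hρ0 : 0 < ρ := by positivity
  have e1 : (s ^ 2 - k * L) / lam * (2 / √k) -
      (a - 2 * L / lam * (k - (s ^ 2 / L - c₀ * s)) / √k) = a * (ρ - 1) := by
    rw [hρ, hc₀]
    field_simp
    ring
  have e2 : ρ ^ 2 - 1 = (s ^ 2 - k * L) / (k * L) := by
    rw [hρ, div_pow, mul_pow, hsL2, hsk2]
    field_simp
  have e3 : |ρ - 1| ≤ |ρ ^ 2 - 1| := by
    rw [show ρ ^ 2 - 1 = (ρ - 1) * (ρ + 1) by ring, abs_mul]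
    apply le_mul_of_one_le_right (abs_nonneg _)
    rw [abs_of_pos (by linarith)]
    linarith
  have e4 : |ρ ^ 2 - 1| ≤ 2 * (L * (|c₀| + 1)) / s := by
    rw [e2, abs_div, abs_of_pos (show 0 < k * L by positivity),
      div_le_div_iff₀ (by positivity) hs0]
    have h1 := abs_sq_sub_mul_le hL hT ht
    have h2 : s ^ 2 ≤ 2 * (k * L) := by
      have := hb.1
      rw [div_le_iff₀ (by positivity)] at this
      linarith
    calc |s ^ 2 - k * L| * s ≤ L * (|c₀| + 1) * s * s := by gcongr
      _ = L * (|c₀| + 1) * s ^ 2 := by ring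
      _ ≤ L * (|c₀| + 1) * (2 * (k * L)) := by gcongr
      _ = _ := by ring
  rw [e1, abs_mul, mul_div_assoc]
  gcongr
  exact e3.trans e4

end levels

theorem one_div_sqrt_le_of_level_bound {L s k : ℝ} (hL : 0 < L) (hs0 : 0 < s)
    (hk : s ^ 2 / (2 * L) ≤ k) : 1 / √k ≤ √(2 * L) / s := by
  have h : s / √(2 * L) ≤ √k := by
    apply Real.le_sqrt_of_sq_le
    rwa [div_pow, Real.sq_sqrt (by positivity)]
  have := one_div_le_one_div_of_le (by positivity) h
  rwa [one_div_div] at this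

theorem le_one_div_sqrt_of_level_bound {L s k : ℝ} (hs0 : 0 < s) (hk0 : 0 < k)
    (hk : k ≤ 2 * s ^ 2 / L) : √(L / 2) / s ≤ 1 / √k := by
  have hL : 0 < L := by
    by_contra! h
    have : 2 * s ^ 2 / L ≤ 0 := div_nonpos_of_nonneg_of_nonpos (by positivity) h
    linarith
  have h : √k ≤ s / √(L / 2) := by
    rw [Real.sqrt_le_left (by positivity), div_pow, Real.sq_sqrt (by positivity)]
    refine hk.trans (le_of_eq ?_)
    field_simp
  have := one_div_le_one_div_of_le (Real.sqrt_pos.2 hk0) h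
  rwa [one_div_div] at this

/-- Expansion of the expected proportion of filled nodes at even levels around the critical one. -/
theorem exists_meanFill_expansion {p q α : ℝ} (hq : 0 < q) (hqp : q < p) (hpq : p + q = 1)
    (hα0 : 0 < α) (hα1 : α < 1) :
    ∃ c D E : ℝ, 0 < c ∧ 0 < D ∧ 0 < E ∧ ∀ T : ℝ, ∀ᶠ n : ℕ in atTop, ∀ m : ℕ, ∀ t : ℝ,
      t = (2 * m : ℕ) - criticalLevel p q (normalQuantile α) n → |t| ≤ T →
      (0 ≤ t → meanFill p q n (2 * m) ≤ α + (D - c * t) / √(Real.log n)) ∧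
      (t ≤ 0 → α - (D + c * t) / √(Real.log n) ≤ meanFill p q n (2 * m)) ∧
      meanFill p q n (2 * m) ≤ α + (D + E * |t|) / √(Real.log n) := by
  have hp := hq.trans hqp
  have hlam : 0 < Real.log (p / q) := Real.log_pos (by rwa [one_lt_div hq])
  have hL := levelRate_pos hp hq hpq
  have hcrit := criticalLevel_eq hq hqp hpq (normalQuantile α)
  have hΦa := normalCDF_normalQuantile hα0 hα1
  set a := normalQuantile α
  set L := levelRate p q with hLdef
  set lam := Real.log (p / q) with hlamdef
  set c₀ := lam / (2 * (L * √L)) * a with hc₀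
  set A := |a| + 1 with hA
  obtain ⟨C, hC, m₀, hBE⟩ := exists_abs_meanFill_sub_normalCDF_le hq hqp hpq (A + 1)
  set W := |a| * (2 * (L * (|c₀| + 1))) with hW
  set φ := gaussianPDFReal 0 1 A with hφ
  have hφ0 : 0 < φ := gaussianPDFReal_pos _ _ _ one_ne_zero
  -- The slope c uses the minimum φ of the normal density on [-A, A] and the lower bound for 1/√k; E
  -- uses density at most 1 and the upper bound. D collects the standardization error W and the
  -- normal approximation error. None depends on T, so T may later be chosen in terms of them.
  refine ⟨φ * (2 * L / lam * √(L / 2)), W + 2 * C * √(2 * L), 2 * L / lam * √(2 * L),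
    by positivity, by positivity, by positivity, fun T => ?_⟩
  filter_upwards [eventually_le_sqrt_log T, eventually_le_sqrt_log (2 * (L * (|c₀| + 1))),
    eventually_le_sqrt_log 1, eventually_le_sqrt_log W,
    eventually_le_sqrt_log (2 * L / lam * √(2 * L) * T), eventually_le_sqrt_log (4 * L * (m₀ + 1)),
    eventually_ge_atTop 2] with n hT hs hs1 hsW hsT hsm hn m t htdef htT
  have hlog : √(Real.log n) ^ 2 = Real.log n := Real.sq_sqrt (Real.log_natCast_nonneg n)
  rw [hcrit n] at htdef
  set s := √(Real.log n) with hsdef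
  set k : ℝ := ((2 * m : ℕ) : ℝ) with hk
  have hs0 : 0 < s := by linarith
  rw [htdef] at htT
  have hb := level_bounds hL hT hs htT
  have hz := abs_standardized_level_sub_le hL hlam hs0 hc₀ hT hs htT
  rw [← htdef] at hz htT
  have hk0 : 0 < k := lt_of_lt_of_le (by positivity) hb.1
  have hku := one_div_sqrt_le_of_level_bound hL hs0 hb.1
  have hkl := le_one_div_sqrt_of_level_bound hs0 hk0 hb.2
  have hkm : k = 2 * m := by rw [hk]; push_cast; ring
  have hm0 : (0 : ℝ) < m := by linarith
  have hmm₀ : m₀ ≤ m := by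
    have h1 : (m₀ + 1 : ℝ) ≤ m := by
      have h2 : 4 * L * (m₀ + 1) ≤ s ^ 2 := by nlinarith
      have h3 := hb.1
      rw [div_le_iff₀ (by positivity), hkm] at h3
      have h4 : 4 * L * ((m₀ : ℝ) + 1) ≤ 4 * L * m := by linarith
      exact le_of_mul_le_mul_left h4 (by positivity)
    have : (m₀ : ℝ) ≤ m := by linarith
    exact_mod_cast this
  set w := 2 * L / lam * t / √k with hw
  have hsqk : 2 / √k = √(2 / (m : ℝ)) := by
    rw [hkm, show (2 : ℝ) / m = 2 ^ 2 / (2 * m) by field_simp,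
      Real.sqrt_div (by positivity), Real.sqrt_sq (by norm_num)]
  set z := (s ^ 2 - k * L) / lam * (2 / √k) with hzdef
  rw [abs_le] at hz
  have hWs : W / s ≤ 1 := by rw [div_le_one hs0]; exact hsW
  have hw1 : |w| ≤ 2 * L / lam * √(2 * L) * |t| / s := by
    rw [hw, abs_div, abs_mul, abs_of_pos (show 0 < 2 * L / lam by positivity),
      abs_of_nonneg (Real.sqrt_nonneg _)]
    calc 2 * L / lam * |t| / √k = 2 * L / lam * |t| * (1 / √k) := by ring
      _ ≤ 2 * L / lam * |t| * (√(2 * L) / s) := by gcongr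
      _ = _ := by ring
  have hw2 : |w| ≤ 1 := by
    refine hw1.trans ?_
    rw [div_le_one hs0]
    refine le_trans ?_ hsT
    gcongr
  have hw2' := abs_le.1 hw2
  have ha1 := neg_abs_le a
  have ha2 := le_abs_self a
  have hzA : |z| ≤ A + 1 := by
    rw [abs_le]
    constructor <;> linarith
  have hmain := hBE m hmm₀ n hn z (by rw [hzdef, hlog, hsqk]) hzA
  have hCm : C / √(m : ℝ) ≤ 2 * C * √(2 * L) / s := by
    have h1 : 1 / √(m : ℝ) ≤ 2 * (1 / √k) := by
      rw [mul_one_div, hsqk]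
      apply Real.le_sqrt_of_sq_le
      rw [div_pow, Real.sq_sqrt hm0.le, one_pow]
      gcongr
      norm_num
    calc C / √(m : ℝ) = C * (1 / √m) := by ring
      _ ≤ C * (2 * (√(2 * L) / s)) := by
        apply mul_le_mul_of_nonneg_left _ hC.le
        linarith
      _ = _ := by ring
  rw [abs_le] at hmain
  have hup : normalCDF z ≤ normalCDF (a - w) + W / s := by
    have h1 := monotone_normalCDF (show z ≤ a - w + W / s by linarith)
    have h2 := normalCDF_sub_le
      (show a - w ≤ a - w + W / s by linarith [show 0 ≤ W / s by positivity])
    linarith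
  have hlo : normalCDF (a - w) - W / s ≤ normalCDF z := by
    have h1 := monotone_normalCDF (show a - w - W / s ≤ z by linarith)
    have h2 := normalCDF_sub_le
      (show a - w - W / s ≤ a - w by linarith [show 0 ≤ W / s by positivity])
    linarith
  have hDs : (W + 2 * C * √(2 * L)) / s = W / s + 2 * C * √(2 * L) / s := add_div _ _ _
  refine ⟨fun ht0 => ?_, fun ht0 => ?_, ?_⟩
  · have hw0 : φ * (2 * L / lam * √(L / 2)) * t / s ≤ φ * w := by
      rw [hw]
      calc _ = φ * (2 * L / lam * t * (√(L / 2) / s)) := by ring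
        _ ≤ φ * (2 * L / lam * t * (1 / √k)) := by gcongr
        _ = _ := by ring
    have hwn : 0 ≤ w := by positivity
    have := le_normalCDF_sub (A := A) (show -A ≤ a - w by linarith) (show a - w ≤ a by linarith)
      (by linarith)
    rw [sub_div, hDs]
    rw [sub_sub_cancel] at this
    linarith
  · have hw0 : φ * w ≤ φ * (2 * L / lam * √(L / 2)) * t / s := by
      rw [hw]
      calc _ = φ * (2 * L / lam * (t * (1 / √k))) := by ring
        _ ≤ φ * (2 * L / lam * (t * (√(L / 2) / s))) := by
          gcongr φ * (2 * L / lam * ?_)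
          exact mul_le_mul_of_nonpos_left hkl ht0
        _ = _ := by ring
    have hwn : w ≤ 0 := by
      rw [hw]
      exact div_nonpos_of_nonpos_of_nonneg
        (mul_nonpos_of_nonneg_of_nonpos (by positivity) ht0) (Real.sqrt_nonneg _)
    have := le_normalCDF_sub (A := A) (show -A ≤ a by linarith) (show a ≤ a - w by linarith)
      (by linarith)
    rw [add_div, hDs]
    rw [sub_sub_cancel_left, mul_neg] at this
    linarith
  · have h1 := (le_abs_self _).trans (abs_normalCDF_sub_le (a - w) a)
    rw [sub_sub_cancel_left, abs_neg] at h1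
    rw [add_div, hDs]
    linarith

theorem exists_crossing {P : ℕ → Prop} {i j : ℕ} (hij : i ≤ j) (hi : P i) (hj : ¬P j) :
    ∃ k, i ≤ k ∧ k < j ∧ P k ∧ ¬P (k + 1) := by
  induction j, hij using Nat.le_induction with
  | base => exact absurd hi hj
  | succ j hij ih =>
    by_cases h : P j
    · exact ⟨j, hij, by omega, h, hj⟩
    · obtain ⟨k, h1, h2, h3⟩ := ih h
      exact ⟨k, h1, by omega, h3⟩

set_option maxHeartbeats 400000 in
/-- For a biased source, the expected proportion of filled nodes crosses `α` within two consecutive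
levels, at a bounded distance of the critical level. -/
theorem exists_crossing_level_of_lt {p q α : ℝ} (hq : 0 < q) (hqp : q < p) (hpq : p + q = 1)
    (hα0 : 0 < α) (hα1 : α < 1) :
    ∃ T C : ℝ, ∀ᶠ n : ℕ in atTop, ∃ k : ℕ,
      |k - criticalLevel p q (normalQuantile α) n| ≤ T ∧
      α + 1 / Real.log n ≤ meanFill p q n k ∧
      meanFill p q n (k + 2) ≤ α - 1 / Real.log n ∧
      meanFill p q n k ≤ α + C / √(Real.log n) := by
  have hp := hq.trans hqp
  have hL := levelRate_pos hp hq hpq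
  have hcrit := criticalLevel_eq hq hqp hpq (normalQuantile α)
  obtain ⟨c, D, E, hc, hD, hE, hexp⟩ := exists_meanFill_expansion hq hqp hpq hα0 hα1
  set a := normalQuantile α
  set L := levelRate p q with hLdef
  set c₀ := Real.log (p / q) / (2 * (L * √L)) * a with hc₀
  -- At distance M from the critical level the linear term cM exceeds the error D by 1, leaving a
  -- margin 1/s. Rounding to even levels, where the expansion applies, moves by at most 2, hence T =
  -- M + 2.
  set M := (D + 1) / c with hM
  have hM0 : 0 < M := by positivity
  have hcM : c * M = D + 1 := by rw [hM]; field_simp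
  set T := M + 2 with hT
  obtain ⟨d, hd, k₀, hdec⟩ := exists_le_meanFill_sub_succ hq hqp hpq
    (L * (|c₀| + 1) * √(2 * L)) (by positivity)
  rw [← hLdef] at hdec
  refine ⟨T, D + E * T, ?_⟩
  filter_upwards [hexp T, eventually_le_sqrt_log (T + 1), eventually_le_sqrt_log 1,
    eventually_le_sqrt_log (2 * (L * (|c₀| + 1))), eventually_le_sqrt_log (2 * L * k₀),
    eventually_le_sqrt_log (2 / (d * √(L / 2))),
    eventually_le_sqrt_log (2 * L * (T + 1)),
    eventually_ge_atTop 2, eventually_ge_atTop k₀] with n hn hsT hs1 hs2 hsk hsd hsT2 hn2 hnk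
  have hlog : √(Real.log n) ^ 2 = Real.log n := Real.sq_sqrt (Real.log_natCast_nonneg n)
  have hanti := meanFill_antitone hp.le hq.le hpq hn2
  have hcr := hcrit n
  set s := √(Real.log n) with hsdef
  rw [← hlog]
  set κ := criticalLevel p q a n with hκ
  have hs0 : 0 < s := by linarith
  have hκT : T + 1 ≤ κ := by
    have h1 := level_bounds (k := κ) (T := 0) (c₀ := c₀) hL hs0.le hs2 (by rw [hcr]; simp)
    refine le_trans ?_ h1.1
    rw [le_div_iff₀ (by positivity), mul_comm]
    exact hsT2.trans (le_self_pow₀ hs1 two_ne_zero)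
  have hinv : 1 / s ^ 2 ≤ 1 / s :=
    one_div_le_one_div_of_le hs0 (le_self_pow₀ hs1 two_ne_zero)
  obtain ⟨m₁, hm₁⟩ : ∃ m : ℕ, m = ⌊(κ - M) / 2⌋₊ := ⟨_, rfl⟩
  obtain ⟨m₂, hm₂⟩ : ∃ m : ℕ, m = ⌈(κ + M) / 2⌉₊ := ⟨_, rfl⟩
  have h1a : (m₁ : ℝ) ≤ (κ - M) / 2 := by rw [hm₁]; exact Nat.floor_le (by linarith)
  have h1b : (κ - M) / 2 < m₁ + 1 := by rw [hm₁]; exact Nat.lt_floor_add_one _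
  have h2a : (κ + M) / 2 ≤ m₂ := by rw [hm₂]; exact Nat.le_ceil _
  have h2b : (m₂ : ℝ) < (κ + M) / 2 + 1 := by rw [hm₂]; exact Nat.ceil_lt_add_one (by linarith)
  have hlow := hn m₁ ((2 * m₁ : ℕ) - κ) rfl
    (by rw [abs_le]; push_cast; constructor <;> linarith)
  have hupp := hn m₂ ((2 * m₂ : ℕ) - κ) rfl
    (by rw [abs_le]; push_cast; constructor <;> linarith)
  have hlow1 : α + 1 / s ≤ meanFill p q n (2 * m₁) := by
    refine le_trans ?_ (hlow.2.1 (by push_cast; linarith))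
    have : D + c * (((2 * m₁ : ℕ) : ℝ) - κ) ≤ -1 := by
      have : ((2 * m₁ : ℕ) : ℝ) - κ ≤ -M := by push_cast; linarith
      have := mul_le_mul_of_nonneg_left this hc.le
      rw [mul_neg, hcM] at this
      linarith
    have h := div_le_div_of_nonneg_right this hs0.le
    rw [neg_div] at h
    linarith
  -- The crossing level found below is at least 2m₁, so monotonicity transfers this upper bound to
  -- it.
  have hlow2 : meanFill p q n (2 * m₁) ≤ α + (D + E * T) / s := by
    refine hlow.2.2.trans ?_
    have : |((2 * m₁ : ℕ) : ℝ) - κ| ≤ T := by rw [abs_le]; push_cast; constructor <;> linarith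
    gcongr
  have hupp1 : meanFill p q n (2 * m₂) ≤ α - 1 / s := by
    refine (hupp.1 (by push_cast; linarith)).trans ?_
    have : D - c * (((2 * m₂ : ℕ) : ℝ) - κ) ≤ -1 := by
      have : M ≤ ((2 * m₂ : ℕ) : ℝ) - κ := by push_cast; linarith
      have := mul_le_mul_of_nonneg_left this hc.le
      rw [hcM] at this
      linarith
    have h := div_le_div_of_nonneg_right this hs0.le
    rw [neg_div] at h
    linarith
  have hmm : 2 * m₁ ≤ 2 * m₂ := by
    have : (m₁ : ℝ) ≤ m₂ := by linarith
    have : m₁ ≤ m₂ := by exact_mod_cast this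
    omega
  have hpos : 0 < 1 / s := by positivity
  have hpos2 : 0 < 1 / s ^ 2 := by positivity
  -- At level k + 1 the mean is below α + 1/s². The drop from k + 1 to k + 2, of order 1/s, is at
  -- least 2/s² and brings it below α - 1/s².
  obtain ⟨k, hk1, hk2, hk3, hk4⟩ := exists_crossing (P := fun k => α + 1 / s ^ 2 ≤ meanFill p q n k)
    hmm (by linarith) (by linarith)
  have hk1' : ((2 * m₁ : ℕ) : ℝ) ≤ k := by exact_mod_cast hk1
  have hk2' : (k : ℝ) + 1 ≤ (2 * m₂ : ℕ) := by exact_mod_cast hk2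
  push_cast at hk1' hk2'
  refine ⟨k, ?_, hk3, ?_, (hanti hk1).trans hlow2⟩
  · rw [abs_le]; constructor <;> linarith
  have htk : |((k + 1 : ℕ) : ℝ) - (s ^ 2 / L - c₀ * s)| ≤ T + 1 := by
    rw [← hcr, abs_le]; push_cast; constructor <;> linarith
  have hb := level_bounds hL hsT hs2 htk
  have hk0 : (0 : ℝ) < ((k + 1 : ℕ) : ℝ) := by positivity
  have hl1 := one_div_sqrt_le_of_level_bound hL hs0 hb.1
  have hl2 := le_one_div_sqrt_of_level_bound hs0 hk0 hb.2
  have hsq := Real.sqrt_pos.2 hk0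
  have hdk := hdec (k + 1) (by
    have h3 : 2 * L * k₀ ≤ s ^ 2 := hsk.trans (le_self_pow₀ hs1 two_ne_zero)
    have h4 := hb.1
    rw [div_le_iff₀ (by positivity)] at h4
    have : (k₀ : ℝ) ≤ ((k + 1 : ℕ) : ℝ) := by
      have h5 : 2 * L * (k₀ : ℝ) ≤ 2 * L * ((k + 1 : ℕ) : ℝ) := by linarith
      exact le_of_mul_le_mul_left h5 (by positivity)
    exact_mod_cast this) n hnk (by
      rw [← hlog]
      refine (abs_sq_sub_mul_le hL hsT htk).trans ?_
      rw [mul_assoc _ (√(2 * L))]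
      gcongr
      rw [div_le_div_iff₀ hsq hs0] at hl1
      linarith)
  have hgap : 2 * (1 / s ^ 2) ≤ d / √((k + 1 : ℕ) : ℝ) := by
    calc 2 * (1 / s ^ 2) = 2 / s / s := by ring
      _ ≤ d * √(L / 2) / s := by
        gcongr
        rw [div_le_iff₀ (by positivity)] at hsd
        rw [div_le_iff₀ hs0]
        linarith
      _ = d * (√(L / 2) / s) := by ring
      _ ≤ d * (1 / √((k + 1 : ℕ) : ℝ)) := by gcongr
      _ = _ := by ring
  rw [show k + 1 + 1 = k + 2 by omega] at hdk
  linarith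

/-! ### The unbiased source, where all cells of a level are equally likely -/

theorem meanFill_half (n k : ℕ) :
    meanFill (1 / 2) (1 / 2) n k = 1 - atMostOneProb n ((1 / 2) ^ k) := by
  rw [meanFill, cellAverage_eq_sum_range]
  calc _ = ∑ j ∈ Finset.range (k + 1), binomProb k j * (1 - atMostOneProb n ((1 / 2) ^ k)) := by
        refine Finset.sum_congr rfl fun j hj => ?_
        have := Finset.mem_range.1 hj
        rw [← pow_add, show j + (k - j) = k by omega]
    _ = _ := by rw [← Finset.sum_mul, sum_binomProb, one_mul]

theorem criticalLevel_half (a : ℝ) (n : ℕ) :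
    criticalLevel (1 / 2) (1 / 2) a n = Real.logb 2 n := by
  rw [criticalLevel, Real.sqrt_mul_self (by norm_num)]
  norm_num

theorem mul_half_pow_eq {n : ℕ} (hn : 0 < n) (k : ℕ) :
    (n : ℝ) * (1 / 2) ^ k = (2 : ℝ) ^ (Real.logb 2 n - k) := by
  have hn' : (0 : ℝ) < n := by exact_mod_cast hn
  rw [Real.rpow_sub two_pos, Real.rpow_logb two_pos (by norm_num) hn', Real.rpow_natCast]
  rw [one_div, inv_pow, div_eq_mul_inv]

/-- For the symmetric source, the expected proportion of filled nodes crosses `α` within two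
consecutive levels, at a bounded distance of `log₂ n`. -/
theorem exists_crossing_level_half {α : ℝ} (hα0 : 0 < α) (hα1 : α < 1) :
    ∃ T : ℝ, ∀ᶠ n : ℕ in atTop, ∃ k : ℕ,
      |k - criticalLevel (1 / 2) (1 / 2) (normalQuantile α) n| ≤ T ∧
      α + 1 / Real.log n ≤ meanFill (1 / 2) (1 / 2) n k ∧
      meanFill (1 / 2) (1 / 2) n (k + 2) ≤ α - 1 / Real.log n := by
  -- Occupancy at least 2^M makes the probability of at most one string at most 9/2^M ≤ (1 - α)/2;
  -- occupancy at most 2^(-M) makes the filling probability at most α.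
  obtain ⟨M, hM1, hM2⟩ : ∃ M : ℕ, 18 / (1 - α) ≤ (2 : ℝ) ^ M ∧ 1 / α ≤ (2 : ℝ) ^ M := by
    obtain ⟨M, hM⟩ := pow_unbounded_of_one_lt (max (18 / (1 - α)) (1 / α)) (one_lt_two (α := ℝ))
    exact ⟨M, (le_max_left _ _).trans hM.le, (le_max_right _ _).trans hM.le⟩
  -- The values y₀ and y₁ bracket the expected occupancy at the level after the crossing, so that b
  -- bounds the next drop from below.
  set y₁ : ℝ := 2 ^ (M + 1) with hy₁
  set y₀ : ℝ := (2 ^ (M + 2))⁻¹ with hy₀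
  set b : ℝ := 1 / 2 * (1 - 1 / 2) * (y₀ ^ 2 / 2 * Real.exp (-(2 * y₁))) with hb
  have hb0 : 0 < b := by rw [hb, hy₀]; norm_num; positivity
  refine ⟨M + 2, ?_⟩
  have hα2 : 0 < (1 - α) / 2 := by linarith
  have hlogb : Tendsto (fun n : ℕ => Real.logb 2 n) atTop atTop :=
    (Real.tendsto_logb_atTop one_lt_two).comp tendsto_natCast_atTop_atTop
  filter_upwards [eventually_ge_atTop 2, hlogb.eventually_ge_atTop ((M : ℝ) + 2),
    tendsto_natCast_atTop_atTop.eventually_ge_atTop (2 * y₁),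
    (Real.tendsto_log_atTop.comp tendsto_natCast_atTop_atTop).eventually_ge_atTop (2 / (1 - α)),
    (Real.tendsto_log_atTop.comp tendsto_natCast_atTop_atTop).eventually_ge_atTop (2 / b)]
    with n hn2 hnM hny hnl hnb
  simp only [Function.comp] at hnl hnb
  have hl0 : 0 < Real.log n := lt_of_lt_of_le (by positivity) hnb
  have hδ1 : 1 / Real.log n ≤ (1 - α) / 2 := by
    rw [div_le_iff₀ (by linarith)] at hnl
    rw [div_le_div_iff₀ hl0 two_pos]; linarith
  have hδ2 : 2 * (1 / Real.log n) ≤ b := by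
    rw [div_le_iff₀ hb0] at hnb
    rw [mul_one_div, div_le_iff₀ hl0]; linarith
  have hδ0 : 0 < 1 / Real.log n := by positivity
  rw [criticalLevel_half]
  set κ := Real.logb 2 n with hκ
  have hx0 : ∀ k : ℕ, (0 : ℝ) < (1 / 2) ^ k := fun k => by positivity
  have hx1 : ∀ k : ℕ, ((1 : ℝ) / 2) ^ k ≤ 1 := fun k => pow_le_one₀ (by norm_num) (by norm_num)
  have hy := mul_half_pow_eq (show 0 < n by omega)
  rw [← hκ] at hy
  obtain ⟨k₁, hk₁⟩ : ∃ m : ℕ, m = ⌊κ - M⌋₊ := ⟨_, rfl⟩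
  obtain ⟨k₂, hk₂⟩ : ∃ m : ℕ, m = ⌈κ + M⌉₊ := ⟨_, rfl⟩
  have h1a : (k₁ : ℝ) ≤ κ - M := by rw [hk₁]; exact Nat.floor_le (by linarith)
  have h1b : κ - M < k₁ + 1 := by rw [hk₁]; exact Nat.lt_floor_add_one _
  have h2a : κ + M ≤ k₂ := by rw [hk₂]; exact Nat.le_ceil _
  have hM0 : (0 : ℝ) ≤ M := by positivity
  have h2b : (k₂ : ℝ) < κ + M + 1 := by rw [hk₂]; exact Nat.ceil_lt_add_one (by linarith)
  have hlow : α + 1 / Real.log n ≤ meanFill (1 / 2) (1 / 2) n k₁ := by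
    rw [meanFill_half]
    have h := atMostOneProb_le_div hn2 (hx0 k₁) (hx1 k₁)
    have h2 : (2 : ℝ) ^ M ≤ n * (1 / 2) ^ k₁ := by
      rw [hy, ← Real.rpow_natCast]
      exact Real.rpow_le_rpow_of_exponent_le one_le_two (by linarith)
    have h3 : 9 / ((n : ℝ) * (1 / 2) ^ k₁) ≤ (1 - α) / 2 := by
      rw [div_le_iff₀ (by linarith)] at hM1
      rw [div_le_iff₀ (by positivity)]
      nlinarith
    linarith
  have hupp : meanFill (1 / 2) (1 / 2) n k₂ ≤ α := by
    rw [meanFill_half]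
    refine (one_sub_atMostOneProb_le (hx0 k₂).le (hx1 k₂)).trans ?_
    have h2 : (n : ℝ) * (1 / 2) ^ k₂ ≤ ((2 : ℝ) ^ M)⁻¹ := by
      rw [hy, ← Real.rpow_natCast, ← Real.rpow_neg two_pos.le]
      exact Real.rpow_le_rpow_of_exponent_le one_le_two (by linarith)
    have h3 : ((2 : ℝ) ^ M)⁻¹ ≤ α := by
      rw [inv_le_comm₀ (by positivity) hα0, ← one_div]; exact hM2
    have h4 : (0 : ℝ) ≤ n * (1 / 2) ^ k₂ := by positivity
    nlinarith
  have hkk : k₁ ≤ k₂ := by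
    have : (k₁ : ℝ) ≤ k₂ := by linarith
    exact_mod_cast this
  obtain ⟨k, hka, hkb, hkc, hkd⟩ := exists_crossing
    (P := fun k => α + 1 / Real.log n ≤ meanFill (1 / 2) (1 / 2) n k) hkk hlow (by linarith)
  have hka' : (k₁ : ℝ) ≤ k := by exact_mod_cast hka
  have hkb' : (k : ℝ) + 1 ≤ k₂ := by exact_mod_cast hkb
  refine ⟨k, ?_, hkc, ?_⟩
  · rw [abs_le]; constructor <;> linarith
  have hdec := le_atMostOneProb_mul_sub (n := n) (q := 1 / 2) (x := (1 / 2) ^ (k + 1)) (y₀ := y₀)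
    (y₁ := y₁) (by norm_num) (by norm_num) (by positivity)
    (by
      rw [hy, hy₀, ← Real.rpow_natCast, ← Real.rpow_neg two_pos.le]
      apply Real.rpow_le_rpow_of_exponent_le one_le_two
      push_cast
      linarith)
    (by
      rw [hy, hy₁, ← Real.rpow_natCast]
      apply Real.rpow_le_rpow_of_exponent_le one_le_two
      push_cast
      linarith)
    (hx0 _).le hn2 hny
  rw [← hb, ← pow_succ'] at hdec
  rw [meanFill_half] at hkd ⊢
  rw [show k + 1 + 1 = k + 2 by omega] at hdec
  linarith

/-! ### An Efron–Stein inequality on finite product spaces -/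

section EfronStein

variable {Ω : Type*} [MeasurableSpace Ω] [Finite Ω] [MeasurableSingletonClass Ω]

theorem integral_sub_const_sq (μ : Measure Ω) [IsProbabilityMeasure μ] (f : Ω → ℝ) (c : ℝ) :
    ∫ x, (f x - c) ^ 2 ∂μ = Var[f; μ] + (∫ x, f x ∂μ - c) ^ 2 := by
  have hv := variance_eq_sub (μ := μ) (X := f) MemLp.of_discrete
  have h1 : ∫ x, (f x - c) ^ 2 ∂μ = ∫ x, ((f ^ 2) x + (-(2 * c) * f x + c ^ 2)) ∂μ := by
    congr 1; ext x; simp only [Pi.pow_apply]; ring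
  rw [h1, integral_add .of_finite .of_finite, integral_add .of_finite .of_finite,
    integral_const_mul, hv]
  simp
  ring

theorem sq_integral_le (μ : Measure Ω) [IsProbabilityMeasure μ] (f : Ω → ℝ) :
    (∫ x, f x ∂μ) ^ 2 ≤ ∫ x, f x ^ 2 ∂μ := by
  have h := integral_sub_const_sq μ f 0
  have hv := variance_nonneg f μ
  simp only [sub_zero] at h
  linarith

theorem integral_pi_fin_succ (μ : Measure Ω) [IsProbabilityMeasure μ] {n : ℕ}
    (F : (Fin (n + 1) → Ω) → ℝ) :
    ∫ w, F w ∂(Measure.pi fun _ => μ) =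
      ∫ x, ∫ y, F (Fin.cons x y) ∂(Measure.pi fun _ : Fin n => μ) ∂μ := by
  have h := (measurePreserving_piFinSuccAbove (fun _ : Fin (n + 1) => μ) 0).symm
  rw [← h.integral_comp', integral_prod _ .of_finite]
  simp [MeasurableEquiv.piFinSuccAbove_symm_apply, Fin.insertNthEquiv, Fin.insertNth_zero']

/-- If `g i` does not depend on the `i`-th coordinate, then the variance of `f` under a product
measure is at most the sum of the mean squares of `f - g i`. -/
theorem variance_pi_le (μ : Measure Ω) [IsProbabilityMeasure μ] {n : ℕ}
    (f : (Fin n → Ω) → ℝ) (g : Fin n → (Fin n → Ω) → ℝ)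
    (hg : ∀ i w x, g i (Function.update w i x) = g i w) :
    Var[f; Measure.pi fun _ => μ] ≤
      ∑ i, ∫ w, (f w - g i w) ^ 2 ∂(Measure.pi fun _ => μ) := by
  induction n with
  | zero =>
    have h := integral_sub_const_sq (Measure.pi fun _ : Fin 0 => μ) f (f default)
    have hf : ∀ w, f w = f default := fun w => congrArg f (Subsingleton.elim _ _)
    simp only [hf, sub_self, ne_eq, OfNat.ofNat_ne_zero, not_false_eq_true, zero_pow,
      integral_zero] at h
    simp only [Finset.univ_eq_empty, Finset.sum_empty]
    have := sq_nonneg (∫ _ : Fin 0 → Ω, f default ∂(Measure.pi fun _ => μ) - f default)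
    linarith
  | succ n ih =>
    set P := Measure.pi fun _ : Fin n => μ
    set m : Ω → ℝ := fun x => ∫ y, f (Fin.cons x y) ∂P with hm
    set E : ℝ := ∫ x, m x ∂μ with hE
    have hmean : ∫ w, f w ∂(Measure.pi fun _ => μ) = E := integral_pi_fin_succ μ f
    -- The law of total variance, conditioning on the first coordinate. Induction handles the
    -- conditional variance, the remaining coordinates being those of `g i.succ`.
    have hvar : Var[f; Measure.pi fun _ => μ] =
        ∫ x, Var[fun y => f (Fin.cons x y); P] ∂μ + Var[m; μ] := by
      have h0 := integral_sub_const_sq (Measure.pi fun _ => μ) f E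
      rw [hmean, sub_self, integral_pi_fin_succ μ fun w => (f w - E) ^ 2] at h0
      have h1 : ∀ x, ∫ y, (f (Fin.cons x y) - E) ^ 2 ∂P =
          Var[fun y => f (Fin.cons x y); P] + (m x - E) ^ 2 := fun x =>
        integral_sub_const_sq P (fun y => f (Fin.cons x y)) E
      have h2 := integral_sub_const_sq μ m E
      rw [integral_congr_ae (Eventually.of_forall h1),
        integral_add .of_finite .of_finite, h2, ← hE, sub_self] at h0
      linarith
    rw [hvar, Fin.sum_univ_succ, add_comm]
    apply add_le_add
    · obtain ⟨x₀⟩ : Nonempty Ω := μ.nonempty_of_neZero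
      -- Since g 0 ignores the first coordinate, its partial integral is the constant c. The
      -- variance of m is at most its mean square distance to c, and Jensen's inequality finishes.
      set c := ∫ y, g 0 (Fin.cons x₀ y) ∂P with hc
      have hgc : ∀ x y, g 0 (Fin.cons x y) = g 0 (Fin.cons x₀ y) := fun x y => by
        rw [← Fin.update_cons_zero (α := fun _ => Ω) x₀ y x, hg]
      have h2 := integral_sub_const_sq μ m c
      have h3 : ∫ x, (m x - c) ^ 2 ∂μ ≤
          ∫ x, ∫ y, (f (Fin.cons x y) - g 0 (Fin.cons x y)) ^ 2 ∂P ∂μ := by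
        apply integral_mono .of_finite .of_finite
        intro x
        have : m x - c = ∫ y, (f (Fin.cons x y) - g 0 (Fin.cons x y)) ∂P := by
          rw [integral_sub .of_finite .of_finite]
          simp_rw [hgc x]
          rfl
        simp only [this]
        exact sq_integral_le P _
      rw [integral_pi_fin_succ]
      nlinarith [sq_nonneg (∫ x, m x ∂μ - c)]
    · calc ∫ x, Var[fun y => f (Fin.cons x y); P] ∂μ
          ≤ ∫ x, ∑ i : Fin n, ∫ y, (f (Fin.cons x y) - g i.succ (Fin.cons x y)) ^ 2 ∂P ∂μ := by
            apply integral_mono .of_finite .of_finite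
            intro x
            apply ih (fun y => f (Fin.cons x y)) (fun i y => g i.succ (Fin.cons x y))
            intro i y z
            simp only [Fin.cons_update, hg]
        _ = _ := by
            rw [integral_finsetSum _ fun _ _ => .of_finite]
            refine Finset.sum_congr rfl fun i _ => ?_
            rw [integral_pi_fin_succ]

end EfronStein

/-! ### Values taken at least twice by a random sample -/

section Collisions

variable {W : Type*} {n : ℕ}

/-- The value `r` is taken at least twice by the sample `w`. -/
def IsTakenTwice (w : Fin n → W) (r : W) : Prop := ∃ i j, i ≠ j ∧ w i = r ∧ w j = r

/-- The value `r` is taken at least twice by the sample `w` after deletion of its `i`-th entry. -/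
def IsTakenTwiceWithout (i : Fin n) (w : Fin n → W) (r : W) : Prop :=
  ∃ a b, a ≠ b ∧ a ≠ i ∧ b ≠ i ∧ w a = r ∧ w b = r

theorem IsTakenTwiceWithout.isTakenTwice {i : Fin n} {w : Fin n → W} {r : W}
    (h : IsTakenTwiceWithout i w r) : IsTakenTwice w r :=
  let ⟨a, b, hab, _, _, ha, hb⟩ := h
  ⟨a, b, hab, ha, hb⟩

theorem isTakenTwiceWithout_update (i : Fin n) (w : Fin n → W) (x r : W) :
    IsTakenTwiceWithout i (Function.update w i x) r ↔ IsTakenTwiceWithout i w r := by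
  unfold IsTakenTwiceWithout
  refine exists_congr fun a => exists_congr fun b => ?_
  refine and_congr_right fun _ => and_congr_right fun ha => and_congr_right fun hb => ?_
  rw [Function.update_of_ne ha, Function.update_of_ne hb]

open scoped Classical in
-- Deleting entry i changes the count by 0 or 1, and by 1 only if its value is taken exactly twice.
-- Each value is thus charged for at most two indices, which gives a bound free of n.
theorem sum_sq_sub_count_without_le [Fintype W] (w : Fin n → W) :
    ∑ i, ((∑ r, if IsTakenTwice w r then (1 : ℝ) else 0) -
      ∑ r, if IsTakenTwiceWithout i w r then (1 : ℝ) else 0) ^ 2 ≤ 2 * Fintype.card W := by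
  set d : Fin n → W → ℝ := fun i r =>
    if IsTakenTwice w r ∧ ¬IsTakenTwiceWithout i w r then 1 else 0 with hd
  have hsub : ∀ i, ((∑ r, if IsTakenTwice w r then (1 : ℝ) else 0) -
      ∑ r, if IsTakenTwiceWithout i w r then (1 : ℝ) else 0) = ∑ r, d i r := fun i => by
    rw [← Finset.sum_sub_distrib]
    refine Finset.sum_congr rfl fun r _ => ?_
    have := @IsTakenTwiceWithout.isTakenTwice W n i w r
    simp only [hd]
    split_ifs <;> simp_all
  have hne : ∀ i r, w i ≠ r → d i r = 0 := fun i r hir => by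
    simp only [hd]
    rw [if_neg]
    rintro ⟨⟨a, b, hab, ha, hb⟩, hnot⟩
    refine hnot ⟨a, b, hab, ?_, ?_, ha, hb⟩
    · rintro rfl; exact hir ha
    · rintro rfl; exact hir hb
  have hsum : ∀ i, ∑ r, d i r = d i (w i) := fun i =>
    Finset.sum_eq_single _ (fun r _ hr => hne i r (Ne.symm hr)) (by simp)
  have hsq : ∀ i, (∑ r, d i r) ^ 2 = ∑ r, d i r := fun i => by
    rw [hsum]
    simp only [hd]
    split_ifs <;> simp
  simp_rw [hsub, hsq]
  rw [Finset.sum_comm]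
  have hr : ∀ r, ∑ i, d i r ≤ 2 := fun r => by
    by_cases h : IsTakenTwice w r
    · obtain ⟨a, b, hab, ha, hb⟩ := h
      calc ∑ i, d i r = ∑ i ∈ {a, b}, d i r := by
            symm
            apply Finset.sum_subset (Finset.subset_univ _)
            intro i _ hi
            simp only [Finset.mem_insert, Finset.mem_singleton, not_or] at hi
            simp only [hd]
            rw [if_neg]
            rintro ⟨_, hnot⟩
            exact hnot ⟨a, b, hab, Ne.symm hi.1, Ne.symm hi.2, ha, hb⟩
        _ ≤ ∑ i ∈ ({a, b} : Finset (Fin n)), 1 := by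
            refine Finset.sum_le_sum fun i _ => ?_
            simp only [hd]
            split_ifs <;> norm_num
        _ = 2 := by rw [Finset.sum_pair hab]; norm_num
    · rw [Finset.sum_eq_zero]
      · norm_num
      · intro i _
        simp only [hd]
        rw [if_neg fun h' => h h'.1]
  calc _ ≤ ∑ r : W, (2 : ℝ) := Finset.sum_le_sum fun r _ => hr r
    _ = _ := by simp [mul_comm]

theorem real_pi_univ_pi [MeasurableSpace W] (ν : Measure W) [IsProbabilityMeasure ν]
    (t : Fin n → Set W) :
    (Measure.pi fun _ : Fin n => ν).real (Set.univ.pi t) = ∏ i, ν.real (t i) := by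
  rw [measureReal_def, Measure.pi_pi, ENNReal.toReal_prod]
  rfl

variable [Fintype W] [MeasurableSpace W] [MeasurableSingletonClass W]

open scoped Classical in
theorem variance_count_isTakenTwice_le (ν : Measure W) [IsProbabilityMeasure ν] :
    Var[fun w : Fin n → W => ∑ r, if IsTakenTwice w r then (1 : ℝ) else 0;
      Measure.pi fun _ => ν] ≤ 2 * Fintype.card W := by
  refine (variance_pi_le ν _
    (fun i w => ∑ r, if IsTakenTwiceWithout i w r then (1 : ℝ) else 0) ?_).trans ?_
  · intro i w x
    simp only [isTakenTwiceWithout_update]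
  · rw [← integral_finsetSum _ fun _ _ => .of_finite]
    refine (integral_mono .of_finite .of_finite sum_sq_sub_count_without_le).trans ?_
    simp

/-- The event is the disjoint union of A, where no entry equals r, and of the B i, where only entry
i does; each is a product set. -/
theorem measureReal_not_isTakenTwice (ν : Measure W) [IsProbabilityMeasure ν] (r : W) :
    (Measure.pi fun _ : Fin n => ν).real {w | ¬IsTakenTwice w r} =
      atMostOneProb n (ν.real {r}) := by
  classical
  set A : Set (Fin n → W) := Set.univ.pi fun _ => {r}ᶜ with hA
  set B : Fin n → Set (Fin n → W) := fun i => Set.univ.pi fun j => if j = i then {r} else {r}ᶜ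
    with hB
  have memB : ∀ i w, w ∈ B i ↔ w i = r ∧ ∀ j, j ≠ i → w j ≠ r := fun i w => by
    simp only [hB, Set.mem_univ_pi]
    constructor
    · intro h
      refine ⟨by simpa using h i, fun j hj => by simpa [hj] using h j⟩
    · rintro ⟨h1, h2⟩ j
      by_cases hj : j = i
      · subst hj; simpa using h1
      · simpa [hj] using h2 j hj
  have memA : ∀ w, w ∈ A ↔ ∀ j, w j ≠ r := fun w => by simp [hA]
  have hset : {w : Fin n → W | ¬IsTakenTwice w r} = A ∪ ⋃ i, B i := by
    ext w
    simp only [Set.mem_ofPred_eq, Set.mem_union, Set.mem_iUnion, memA, memB]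
    constructor
    · intro h
      by_cases hex : ∃ i, w i = r
      · obtain ⟨i, hi⟩ := hex
        exact Or.inr ⟨i, hi, fun j hj hjr => h ⟨j, i, hj, hjr, hi⟩⟩
      · exact Or.inl fun j hj => hex ⟨j, hj⟩
    · rintro (h | ⟨i, hi, h⟩) ⟨a, b, hab, ha, hb⟩
      · exact h a ha
      · have h1 : a = i := by_contra fun hne => h a hne ha
        have h2 : b = i := by_contra fun hne => h b hne hb
        exact hab (h1.trans h2.symm)
  have hdisj : Pairwise (Function.onFun Disjoint B) := fun i j hij => by
    rw [Function.onFun, Set.disjoint_left]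
    intro w hi hj
    rw [memB] at hi hj
    exact hj.2 i hij hi.1
  have hdisj' : Disjoint A (⋃ i, B i) := by
    rw [Set.disjoint_left]
    intro w hw hi
    obtain ⟨i, hi⟩ := Set.mem_iUnion.1 hi
    rw [memB] at hi
    exact (memA w).1 hw i hi.1
  have hc : ν.real {r}ᶜ = 1 - ν.real {r} := probReal_compl_eq_one_sub (measurableSet_singleton r)
  rw [hset, measureReal_union hdisj' (Set.toFinite _).measurableSet,
    measureReal_iUnion_fintype hdisj (fun i => (Set.toFinite _).measurableSet), hA,
    real_pi_univ_pi]
  have hBi : ∀ i, (Measure.pi fun _ : Fin n => ν).real (B i) =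
      ν.real {r} * (1 - ν.real {r}) ^ (n - 1) := fun i => by
    rw [hB, real_pi_univ_pi, ← Finset.mul_prod_erase _ _ (Finset.mem_univ i), if_pos rfl]
    congr 1
    rw [Finset.prod_congr rfl (g := fun _ => 1 - ν.real {r})
      (fun j hj => by rw [if_neg (Finset.ne_of_mem_erase hj), hc])]
    simp
  simp_rw [hBi, hc]
  simp [atMostOneProb, mul_assoc]

open scoped Classical in
theorem integral_count_isTakenTwice (ν : Measure W) [IsProbabilityMeasure ν] :
    ∫ w : Fin n → W, (∑ r, if IsTakenTwice w r then (1 : ℝ) else 0) ∂(Measure.pi fun _ => ν) =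
      ∑ r, (1 - atMostOneProb n (ν.real {r})) := by
  rw [integral_finsetSum _ fun _ _ => .of_finite]
  refine Finset.sum_congr rfl fun r _ => ?_
  rw [← measureReal_not_isTakenTwice (n := n) ν r,
    ← probReal_compl_eq_one_sub (Set.toFinite _).measurableSet,
    ← integral_indicator_one (Set.toFinite _).measurableSet]
  congr 1
  ext w
  simp [Set.indicator_apply]

end Collisions

/-! ### Mean and variance of the proportion of filled nodes -/

/-- The prefix of length `k` of an infinite string. -/
def prefixWord (k : ℕ) (x : ℕ → Bool) : Fin k → Bool := fun j => x j

theorem measurable_prefixWord (k : ℕ) : Measurable (prefixWord k) :=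
  measurable_pi_lambda _ fun _ => measurable_pi_apply _

theorem isPrefix_iff {k : ℕ} (r : Fin k → Bool) (x : ℕ → Bool) :
    IsPrefix r x ↔ prefixWord k x = r :=
  funext_iff.symm

theorem isInternalNode_iff {n k : ℕ} (s : Fin n → ℕ → Bool) (r : Fin k → Bool) :
    IsInternalNode s r ↔ IsTakenTwice (fun i => prefixWord k (s i)) r := by
  simp only [IsInternalNode, IsTakenTwice, isPrefix_iff]

open scoped Classical in
theorem internalCount_eq_sum {n : ℕ} (s : Fin n → ℕ → Bool) (k : ℕ) :
    (internalCount s k : ℝ) =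
      ∑ r, if IsTakenTwice (fun i => prefixWord k (s i)) r then (1 : ℝ) else 0 := by
  rw [internalCount, Nat.card_eq_fintype_card, Fintype.card_subtype, Finset.sum_boole]
  simp only [isInternalNode_iff]

noncomputable section

/-- The law of the prefix of length `k` of a random string. -/
def wordLaw (p : unitInterval) (k : ℕ) : Measure (Fin k → Bool) :=
  (stringLaw p).map (prefixWord k)

instance (p : unitInterval) (k : ℕ) : IsProbabilityMeasure (wordLaw p k) :=
  Measure.isProbabilityMeasure_map (measurable_prefixWord k).aemeasurable

end

/-- Level k depends only on prefixes of length k, so moments can be computed on a finite product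
space, where the Efron–Stein bound applies. -/
theorem measurePreserving_prefixWords (p : unitInterval) (n k : ℕ) :
    MeasurePreserving (fun (s : Fin n → ℕ → Bool) i => prefixWord k (s i)) (sampleLaw p n)
      (Measure.pi fun _ => wordLaw p k) := by
  constructor
  · exact measurable_pi_lambda _ fun i => (measurable_prefixWord k).comp (measurable_pi_apply i)
  · have : ∀ _ : Fin n, SigmaFinite ((stringLaw p).map (prefixWord k)) := fun _ =>
      inferInstanceAs (SigmaFinite (wordLaw p k))
    exact Measure.pi_map_pi (μ := fun _ : Fin n => stringLaw p) (f := fun _ => prefixWord k)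
      fun _ => (measurable_prefixWord k).aemeasurable

theorem wordLaw_real_singleton (p : unitInterval) {k : ℕ} (r : Fin k → Bool) :
    (wordLaw p k).real {r} = ∏ j, if r j then (p : ℝ) else 1 - p := by
  -- For i ≥ k the condition is vacuous; indexing by all of ℕ puts the cylinder in the form needed
  -- for the infinite product measure.
  set t : ℕ → Set Bool := fun i => {b | ∀ h : i < k, b = r ⟨i, h⟩} with ht
  have hpre : prefixWord k ⁻¹' {r} = ((Finset.range k : Finset ℕ) : Set ℕ).pi t := by
    ext x
    simp only [Set.mem_preimage, Set.mem_singleton_iff, ht, Set.mem_pi, Finset.coe_range,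
      Set.mem_Iio, Set.mem_ofPred_eq]
    constructor
    · intro h i hi _
      rw [← h]; rfl
    · intro h
      funext j
      exact h j j.2 j.2
  rw [wordLaw, map_measureReal_apply (measurable_prefixWord k) (measurableSet_singleton r), hpre,
    measureReal_def, stringLaw, Measure.infinitePi_pi _ fun i _ => (Set.toFinite _).measurableSet,
    ENNReal.toReal_prod, Finset.prod_range]
  refine Finset.prod_congr rfl fun j _ => ?_
  have htj : t j = {r j} := by
    ext b; simp [ht]
  rw [htj, ← measureReal_def]
  cases hj : r j
  · rw [bernoulliMeasure_real_apply_of_notMem_of_mem p (measurableSet_singleton _) (by simp)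
      (by simp)]
    simp
  · rw [bernoulliMeasure_real_apply_of_mem_of_notMem p (measurableSet_singleton _) (by simp)
      (by simp)]
    simp

/-- Splitting off the first letter of a word matches the recursion `cellAverage_succ`, so no count
of words by number of ones is needed. -/
theorem sum_words_eq_cellAverage (p q : ℝ) (k : ℕ) (F : ℝ → ℝ) :
    (∑ r : Fin k → Bool, F (∏ j, if r j then p else q)) / 2 ^ k = cellAverage p q k F := by
  induction k generalizing F with
  | zero => simp [cellAverage]
  | succ k ih =>
    rw [cellAverage_succ, ← ih, ← (Fin.consEquiv fun _ => Bool).sum_comp, Fintype.sum_prod_type,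
      Fintype.sum_bool, ← Finset.sum_add_distrib, ← Finset.sum_div, pow_succ, div_div,
      mul_comm (2 ^ k : ℝ)]
    congr 1
    refine Finset.sum_congr rfl fun r _ => ?_
    simp [Fin.consEquiv, Fin.prod_univ_succ]

theorem integral_fillProportion (p : unitInterval) (n k : ℕ) :
    ∫ s, fillProportion s k ∂(sampleLaw p n) = meanFill p (1 - p) n k := by
  classical
  simp only [fillProportion, internalCount_eq_sum]
  have hmp := measurePreserving_prefixWords p n k
  rw [integral_div, ← integral_map (f := fun w : Fin n → Fin k → Bool =>
    ∑ r, if IsTakenTwice w r then (1 : ℝ) else 0) hmp.measurable.aemeasurable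
    (measurable_of_finite _).aestronglyMeasurable, hmp.map_eq, integral_count_isTakenTwice,
    meanFill, ← sum_words_eq_cellAverage]
  simp only [wordLaw_real_singleton]

theorem memLp_fillProportion (p : unitInterval) (n k : ℕ) :
    MemLp (fun s => fillProportion s k) 2 (sampleLaw p n) := by
  classical
  have h : MemLp (fun w : Fin n → Fin k → Bool =>
      (∑ r, if IsTakenTwice w r then (1 : ℝ) else 0) / 2 ^ k) 2
      (Measure.pi fun _ => wordLaw p k) := MemLp.of_discrete
  have := h.comp_measurePreserving (measurePreserving_prefixWords p n k)
  simp only [fillProportion, internalCount_eq_sum]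
  exact this

theorem variance_fillProportion_le (p : unitInterval) (n k : ℕ) :
    Var[fun s => fillProportion s k; sampleLaw p n] ≤ 2 / 2 ^ k := by
  classical
  have hmp := measurePreserving_prefixWords p n k
  have h1 : (fun s : Fin n → ℕ → Bool => fillProportion s k) =
      fun s => (2 ^ k : ℝ)⁻¹ * ((fun w : Fin n → Fin k → Bool =>
        ∑ r, if IsTakenTwice w r then (1 : ℝ) else 0) ∘ fun s i => prefixWord k (s i)) s := by
    ext s
    rw [fillProportion, internalCount_eq_sum, div_eq_inv_mul]
    rfl
  rw [h1, variance_const_mul, ← variance_map (measurable_of_finite _).aemeasurable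
    hmp.measurable.aemeasurable, hmp.map_eq]
  have h2 := variance_count_isTakenTwice_le (n := n) (wordLaw p k)
  have hcard : (Fintype.card (Fin k → Bool) : ℝ) = 2 ^ k := by simp
  rw [hcard] at h2
  calc _ ≤ ((2 ^ k : ℝ)⁻¹) ^ 2 * (2 * 2 ^ k) := by gcongr
    _ = _ := by field_simp

/-! ### Concentration of the fillup level -/

/-- The parent of an internal node is internal, and a node is determined by its parent and its last
letter. Hence the fill proportion decreases with the level for every sample. -/
theorem internalCount_succ_le {n : ℕ} (s : Fin n → ℕ → Bool) (k : ℕ) :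
    internalCount s (k + 1) ≤ 2 * internalCount s k := by
  let φ : {r : Fin (k + 1) → Bool // IsInternalNode s r} →
      Bool × {r : Fin k → Bool // IsInternalNode s r} := fun r =>
    (r.1 (Fin.last k), ⟨Fin.init r.1, by
      obtain ⟨i, j, hij, hi, hj⟩ := r.2
      exact ⟨i, j, hij, fun l => hi l.castSucc, fun l => hj l.castSucc⟩⟩)
  have hφ : Function.Injective φ := by
    intro a b hab
    have h1 : a.1 (Fin.last k) = b.1 (Fin.last k) := congrArg Prod.fst hab
    have h2 : Fin.init a.1 = Fin.init b.1 := congrArg (fun x => x.2.1) hab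
    apply Subtype.ext
    rw [← Fin.snoc_init_self a.1, ← Fin.snoc_init_self b.1, h1, h2]
  have := Nat.card_le_card_of_injective φ hφ
  rwa [Nat.card_prod, Nat.card_eq_fintype_card (α := Bool), Fintype.card_bool] at this

theorem fillProportion_antitone {n : ℕ} (s : Fin n → ℕ → Bool) : Antitone (fillProportion s) := by
  apply antitone_nat_of_succ_le
  intro k
  have h : (internalCount s (k + 1) : ℝ) ≤ 2 * internalCount s k := by
    exact_mod_cast internalCount_succ_le s k
  rw [fillProportion, fillProportion, div_le_div_iff₀ (by positivity) (by positivity), pow_succ]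
  have : (0 : ℝ) < 2 ^ k := by positivity
  nlinarith

theorem fillupLevel_eq_or_eq {n : ℕ} (hn : 2 ≤ n) {α : ℝ} (hα0 : 0 < α) (hα1 : α ≤ 1)
    {s : Fin n → ℕ → Bool} {k : ℕ} (h1 : α ≤ fillProportion s k)
    (h2 : fillProportion s (k + 2) < α) : fillupLevel α s = k ∨ fillupLevel α s = k + 1 := by
  obtain ⟨hmem, hub⟩ := isGreatest_fillupLevel hn hα0 hα1 s
  have hle : k ≤ fillupLevel α s := hub h1
  have hlt : fillupLevel α s < k + 2 := by
    by_contra! h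
    have h3 : α ≤ fillProportion s (fillupLevel α s) := hmem
    linarith [fillProportion_antitone s h]
  omega

theorem measure_fillProportion_deviation_le (p : unitInterval) (n k : ℕ) {δ : ℝ} (hδ : 0 < δ) :
    sampleLaw p n {s | δ ≤ |fillProportion s k - meanFill p (1 - p) n k|} ≤
      ENNReal.ofReal (2 / 2 ^ k / δ ^ 2) := by
  have h := meas_ge_le_variance_div_sq (memLp_fillProportion p n k) hδ
  rw [integral_fillProportion] at h
  refine h.trans (ENNReal.ofReal_le_ofReal ?_)
  gcongr
  exact variance_fillProportion_le p n k

/-- If the expected proportion of filled nodes crosses `α` with a margin `δ` within two levels,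
then the fillup level is one of two values with high probability. -/
theorem le_measure_fillupLevel (p : unitInterval) {n k : ℕ} (hn : 2 ≤ n) {α δ : ℝ} (hα0 : 0 < α)
    (hα1 : α ≤ 1) (hδ : 0 < δ) (h1 : α + δ ≤ meanFill p (1 - p) n k)
    (h2 : meanFill p (1 - p) n (k + 2) ≤ α - δ) :
    1 - ENNReal.ofReal (4 / 2 ^ k / δ ^ 2) ≤
      sampleLaw p n {s | fillupLevel α s = k ∨ fillupLevel α s = k + 1} := by
  set G := {s : Fin n → ℕ → Bool | fillupLevel α s = k ∨ fillupLevel α s = k + 1}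
  set A := {s : Fin n → ℕ → Bool | δ ≤ |fillProportion s k - meanFill p (1 - p) n k|}
  set B := {s : Fin n → ℕ → Bool | δ ≤ |fillProportion s (k + 2) - meanFill p (1 - p) n (k + 2)|}
  -- Only monotonicity and subadditivity of the measure follow, so measurability of the fillup event
  -- plays no role.
  have hsub : Set.univ ⊆ G ∪ (A ∪ B) := by
    intro s _
    by_contra hs
    simp only [Set.mem_union, not_or] at hs
    obtain ⟨hG, hA, hB⟩ := hs
    rw [Set.mem_ofPred_eq] at hA hB
    have hA' := abs_lt.1 (not_le.1 hA)
    have hB' := abs_lt.1 (not_le.1 hB)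
    exact hG (fillupLevel_eq_or_eq hn hα0 hα1 (by linarith) (by linarith))
  have hA := measure_fillProportion_deviation_le p n k hδ
  have hB := measure_fillProportion_deviation_le p n (k + 2) hδ
  have hB2 : ENNReal.ofReal (2 / 2 ^ (k + 2) / δ ^ 2) ≤ ENNReal.ofReal (2 / 2 ^ k / δ ^ 2) := by
    apply ENNReal.ofReal_le_ofReal
    gcongr
    · norm_num
    · omega
  rw [tsub_le_iff_right]
  calc (1 : ENNReal) = sampleLaw p n Set.univ := measure_univ.symm
    _ ≤ sampleLaw p n (G ∪ (A ∪ B)) := measure_mono hsub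
    _ ≤ sampleLaw p n G + (sampleLaw p n A + sampleLaw p n B) :=
      (measure_union_le _ _).trans (add_le_add le_rfl (measure_union_le _ _))
    _ ≤ sampleLaw p n G + (ENNReal.ofReal (2 / 2 ^ k / δ ^ 2) +
          ENNReal.ofReal (2 / 2 ^ k / δ ^ 2)) := by
      gcongr
      exact hB.trans hB2
    _ = _ := by
      rw [← ENNReal.ofReal_add (by positivity) (by positivity)]
      congr 2
      ring

/-- The expected proportion of filled nodes crosses `α` within two consecutive levels, at a bounded
distance of the critical level. -/
theorem exists_crossing_level {p q α : ℝ} (hp : 0 < p) (hq : 0 < q) (hpq : p + q = 1)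
    (hα0 : 0 < α) (hα1 : α < 1) :
    ∃ T C : ℝ, ∀ᶠ n : ℕ in atTop, ∃ k : ℕ,
      |k - criticalLevel p q (normalQuantile α) n| ≤ T ∧
      α + 1 / Real.log n ≤ meanFill p q n k ∧
      meanFill p q n (k + 2) ≤ α - 1 / Real.log n ∧
      (p ≠ 1 / 2 → meanFill p q n k ≤ α + C / √(Real.log n)) := by
  rcases lt_trichotomy q p with h | h | h
  · obtain ⟨T, C, hTC⟩ := exists_crossing_level_of_lt hq h hpq hα0 hα1
    refine ⟨T, C, hTC.mono fun n ⟨k, h1, h2, h3, h4⟩ => ⟨k, h1, h2, h3, fun _ => h4⟩⟩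
  · have hp2 : p = 1 / 2 := by linarith
    have hq2 : q = 1 / 2 := by linarith
    obtain ⟨T, hT⟩ := exists_crossing_level_half hα0 hα1
    subst hp2 hq2
    exact ⟨T, 0, hT.mono fun n ⟨k, h1, h2, h3⟩ => ⟨k, h1, h2, h3, fun h => absurd rfl h⟩⟩
  · obtain ⟨T, C, hTC⟩ := exists_crossing_level_of_lt hp h (by linarith) hα0 hα1
    refine ⟨T, C, hTC.mono fun n ⟨k, h1, h2, h3, h4⟩ => ⟨k, ?_, ?_, ?_, fun _ => ?_⟩⟩
    · rwa [criticalLevel_comm]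
    · rwa [meanFill_comm]
    · rwa [meanFill_comm]
    · rwa [meanFill_comm]

/-- The √(ln n) correction is eventually absorbed by half of the main term. This makes 2^k at least
a constant times a positive power of n, which beats the factor (ln n)² in Chebyshev's bound. -/
theorem exists_mul_log_le_criticalLevel {p q : ℝ} (hp : 0 < p) (hq : 0 < q) (hpq : p + q = 1)
    (a : ℝ) : ∃ c : ℝ, 0 < c ∧ ∀ᶠ n : ℕ in atTop, c * Real.log n ≤ criticalLevel p q a n := by
  have hL := levelRate_pos hp hq hpq
  set B := |Real.log (p / q)| / (2 * Real.log (1 / √(p * q)) ^ (3 / 2 : ℝ)) * a with hB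
  refine ⟨1 / (2 * levelRate p q), by positivity, ?_⟩
  filter_upwards [eventually_le_sqrt_log (B * (2 * levelRate p q))] with n hn
  have hlog : √(Real.log n) ^ 2 = Real.log n := Real.sq_sqrt (Real.log_natCast_nonneg n)
  rw [criticalLevel, ← hB, Real.logb, ← levelRate]
  have h : B * √(Real.log n) ≤ Real.log n / (2 * levelRate p q) := by
    rw [le_div_iff₀ (by positivity)]
    nlinarith [Real.sqrt_nonneg (Real.log n)]
  have e : Real.log n / levelRate p q =
      Real.log n / (2 * levelRate p q) + Real.log n / (2 * levelRate p q) := by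
    field_simp; ring
  rw [one_div_mul_eq_div]
  linarith

theorem tendsto_deviation_bound {c T : ℝ} (hc : 0 < c) {k : ℕ → ℕ}
    (hk : ∀ᶠ n : ℕ in atTop, c * Real.log n - T ≤ k n) :
    Tendsto (fun n : ℕ => 4 / 2 ^ k n / (1 / Real.log n) ^ 2) atTop (𝓝 0) := by
  have hlog : Tendsto (fun n : ℕ => Real.log n) atTop atTop :=
    Real.tendsto_log_atTop.comp tendsto_natCast_atTop_atTop
  set b := Real.log 2 * c with hb
  have hb0 : 0 < b := mul_pos (Real.log_pos one_lt_two) hc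
  have h0 : Tendsto (fun x : ℝ => x ^ 2 * Real.exp (-(b * x))) atTop (𝓝 0) := by
    have := Real.tendsto_pow_mul_exp_neg_atTop_nhds_zero 2
    have h1 := (this.comp (tendsto_id.const_mul_atTop hb0)).const_mul (1 / b ^ 2)
    rw [mul_zero] at h1
    refine h1.congr fun x => ?_
    simp only [Function.comp, id]
    field_simp
  have h1 : Tendsto (fun n : ℕ => 4 * Real.exp (Real.log 2 * T) *
      (Real.log n ^ 2 * Real.exp (-(b * Real.log n)))) atTop (𝓝 0) := by
    have := (h0.comp hlog).const_mul (4 * Real.exp (Real.log 2 * T))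
    rwa [mul_zero] at this
  refine squeeze_zero' (Eventually.of_forall fun n => by positivity) ?_ h1
  filter_upwards [hk] with n hn
  have h2 : ((2 : ℝ) ^ k n)⁻¹ ≤ Real.exp (Real.log 2 * T) * Real.exp (-(b * Real.log n)) := by
    rw [← Real.exp_add, ← Real.exp_log (show (0 : ℝ) < 2 ^ k n by positivity), ← Real.exp_neg,
      Real.log_pow]
    apply Real.exp_le_exp.2
    have := Real.log_pos (one_lt_two (α := ℝ))
    rw [hb]
    nlinarith
  calc 4 / 2 ^ k n / (1 / Real.log n) ^ 2 = 4 * ((2 : ℝ) ^ k n)⁻¹ * Real.log n ^ 2 := by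
        rw [one_div, inv_pow, div_inv_eq_mul, div_eq_mul_inv]
    _ ≤ 4 * (Real.exp (Real.log 2 * T) * Real.exp (-(b * Real.log n))) * Real.log n ^ 2 := by
        gcongr
    _ = _ := by ring

end Trie

/-! ### Proof of the theorem -/

theorem theorem1 (α : ℝ) (hα0 : 0 < α) (hα1 : α < 1)
    (p : unitInterval) (hp0 : 0 < (p : ℝ)) (hp1 : (p : ℝ) < 1)
    (q : ℝ) (hq : q = 1 - (p : ℝ)) :
    ∃ k : ℕ → ℕ,
      ((fun n : ℕ => (k n : ℝ) -
          (Real.logb (1 / √((p : ℝ) * q)) n -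
            |Real.log ((p : ℝ) / q)| / (2 * Real.log (1 / √((p : ℝ) * q)) ^ (3 / 2 : ℝ)) *
              Trie.normalQuantile α * √(Real.log n)))
        =O[atTop] (fun _ : ℕ => (1 : ℝ))) ∧
      Tendsto (fun n : ℕ => Trie.sampleLaw p n
          {s | Trie.fillupLevel α s = k n ∨ Trie.fillupLevel α s = k n + 1})
        atTop (𝓝 1) ∧
      ((p : ℝ) ≠ 1 / 2 →
        (fun n : ℕ => (∫ s, Trie.fillProportion s (k n) ∂(Trie.sampleLaw p n)) - α)
          =O[atTop] (fun n : ℕ => 1 / √(Real.logb 2 n))) := by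
  have hq0 : 0 < q := by linarith
  obtain ⟨T, C, hTC⟩ := Trie.exists_crossing_level hp0 hq0 (by linarith) hα0 hα1
  rw [eventually_atTop] at hTC
  obtain ⟨n₀, hn₀⟩ := hTC
  -- The values of k below n₀ are arbitrary; every claim is asymptotic.
  choose! k hk using hn₀
  have hev : ∀ᶠ n : ℕ in atTop, 1 ≤ Real.log n :=
    (Real.tendsto_log_atTop.comp tendsto_natCast_atTop_atTop).eventually_ge_atTop 1
  refine ⟨k, ?_, ?_, fun hp2 => ?_⟩
  · refine IsBigO.of_bound T ?_
    filter_upwards [eventually_ge_atTop n₀] with n hn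
    rw [norm_one, mul_one, Real.norm_eq_abs]
    exact (hk n hn).1
  · obtain ⟨c, hc, hcrit⟩ := Trie.exists_mul_log_le_criticalLevel hp0 hq0 (by linarith)
      (Trie.normalQuantile α)
    have hlow : ∀ᶠ n : ℕ in atTop, c * Real.log n - T ≤ k n := by
      filter_upwards [hcrit, eventually_ge_atTop n₀] with n h1 h2
      have := (abs_le.1 (hk n h2).1).1
      linarith
    have hlim := ENNReal.tendsto_ofReal (Trie.tendsto_deviation_bound hc hlow)
    rw [ENNReal.ofReal_zero] at hlim
    have hlim2 := ENNReal.Tendsto.sub (tendsto_const_nhds (x := (1 : ENNReal))) hlim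
      (Or.inl ENNReal.one_ne_top)
    rw [tsub_zero] at hlim2
    refine tendsto_of_tendsto_of_tendsto_of_le_of_le' hlim2 tendsto_const_nhds ?_
      (Eventually.of_forall fun n => prob_le_one)
    filter_upwards [eventually_ge_atTop n₀, eventually_ge_atTop 2, hev] with n h1 h2 h3
    subst hq
    exact Trie.le_measure_fillupLevel p h2 hα0 hα1.le (by positivity) (hk n h1).2.1 (hk n h1).2.2.1
  -- The factor converts ln n into log₂ n. No lower estimate is needed, because the mean at the
  -- crossing level is at least α.
  · refine IsBigO.of_bound (C * √(1 / Real.log 2)) ?_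
    filter_upwards [eventually_ge_atTop n₀, hev] with n h1 h3
    obtain ⟨-, h4, -, h5⟩ := hk n h1
    have hl2 := Real.log_pos (one_lt_two (α := ℝ))
    rw [Trie.integral_fillProportion, ← hq, Real.norm_eq_abs, Real.norm_eq_abs,
      abs_of_nonneg (by have : 0 < 1 / Real.log n := by positivity
                        linarith), abs_of_nonneg (by positivity)]
    have e : C * √(1 / Real.log 2) * (1 / √(Real.logb 2 n)) = C / √(Real.log n) := by
      rw [Real.logb, Real.sqrt_div zero_le_one, Real.sqrt_div (by linarith), Real.sqrt_one]
      field_simp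
    rw [e]
    linarith [h5 hp2]
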